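/- Write $\overline{\mathbb C}=\mathbb C\sqcup\{\infty\}$, $\overline{\mathbb R}=\mathbb R\sqcup\{\infty\}\subset\overline{\mathbb C}$, $\mathbb C_\pm=\{w\in\mathbb C:\pm\operatorname{Im}w>0\}$, $\mathbb T=\{|z|=1\}$, and fix one of the two signs $\pm$. Let $\varphi$ be a holomorphic function on $U\cap\mathbb C_\pm$ for some open neighborhood $U$ of $\overline{\mathbb R}$ in $\overline{\mathbb C}$, and put $\widetilde\varphi(w)=\varphi(-1/w)$. We say that $\varphi$ behaves simply at $s\pm i0$ ($s\in\mathbb R$) if $(\operatorname{Im}w)\,\varphi(w)$ is bounded on $U'\cap\mathbb C_\pm$ for some neighborhood $U'$ of $s$, and that it behaves simply at $\infty\pm i0$ if $\widetilde\varphi$ behaves simply at $0\pm i0$. Let $C^\infty(\overline{\mathbb R})$ be the space of functions $f:\overline{\mathbb R}\to\mathbb C$ such that both $x\mapsto f(x)$ and $x\mapsto f(-1/x)$ (with value $f(\infty)$ at $x=0$) are $C^\infty$ on $\mathbb R$. Let $$\phi(z)=-i\,\varphi\Bigl(i\,\frac{1-z}{1+z}\Bigr)$$ be the Möbius transform of $\varphi$,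 defined near $\mathbb T$ inside the unit disk for the upper sign and outside it for the lower sign. **Theorem.** Suppose that $\varphi$ behaves simply at $s\pm i0$ for every $s\in\overline{\mathbb R}$. Then: 1. $\widetilde\varphi$ is also holomorphic on $V\cap\mathbb C_\pm$ for some open neighborhood $V$ of $\overline{\mathbb R}$ in $\overline{\mathbb C}$, and behaves simply at $s\pm i0$ for every $s\in\overline{\mathbb R}$. 2. The limits $\varphi(x\pm i0)=\lim_{y\to+0}\varphi(x\pm iy)$ and $\widetilde\varphi(x\pm i0)=\lim_{y\to+0}\widetilde\varphi(x\pm iy)$ exist as distributions on $\mathbb R$, i.e. when integrated against any $f\in C_c^\infty(\mathbb R)$. 3. For every $f\in C_c^\infty(\mathbb R\setminus\{0\})$, with $\widetilde f(x)=f(-1/x)$, $$\int_{\mathbb R\setminus\{0\}} f(x)\,\frac{\varphi(x\pm i0)}{1+x^2}\,dx=\int_{\mathbb R\setminus\{0\}}\widetilde f(x)\,\frac{\widetilde\varphi(x\pm i0)}{1+x^2}\,dx .$$ 4. Consequently there is a unique distribution $J$ on $\overline{\mathbb R}$ that equals $\varphi(x\pm i0)/(1+x^2)$ on $\mathbb R$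 and equals the inversion of $\widetilde\varphi(x\pm i0)/(1+x^2)$ on $\overline{\mathbb R}\setminus\{0\}$; write $J(f)=\int_{\overline{\mathbb R}}f(s)\,\varphi(s\pm i0)\,\frac{ds}{1+s^2}$. The limit $\phi(e^{it\mp0})=\lim_{r\to1\mp0}\phi(re^{it})$ exists as a distribution on $\mathbb T$ (that is, on $2\pi$-periodic $C^\infty$ functions of $t$), and for every $f\in C^\infty(\overline{\mathbb R})$ $$\oint_{2\pi} f\Bigl(\tan\frac t2\Bigr)\,\phi(e^{it\mp0})\,dt=-i\int_{\overline{\mathbb R}}f(s)\,\varphi(s\pm i0)\,\frac{2}{1+s^2}\,ds .$$ -/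

import Mathlib

open Real Set Filter Topology MeasureTheory TopologicalSpace
open scoped ContDiff Distributions

noncomputable section

namespace BoundaryDistribution

/-! ### Sides of the real line, inversion, boundary neighbourhoods, simple behaviour

The Riemann sphere is `OnePoint ℂ`, the extended real line is `OnePoint ℝ`. -/

/-- The side from which the real line is approached: `upper` stands for `+ i0`, `lower` for
`- i0`. -/
inductive Side : Type
  | upper
  | lower

/-- The sign `±1` of a side. -/
def Side.sign : Side → ℝ
  | .upper => 1
  | .lower => -1

/-- The open half plane `ℂ₊` or `ℂ₋`. -/
def Side.halfPlane (σ : Side) : Set ℂ := {z | 0 < σ.sign * z.im}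

/-- The way in which the radius of a circle centred at `0` tends to `1`: from inside the unit disk
for `upper`, from outside for `lower`. -/
def Side.radius : Side → Filter ℝ
  | .upper => 𝓝[<] 1
  | .lower => 𝓝[>] 1

/-- The inversion `w ↦ φ (-1 / w)` of a function `φ`. -/
def inversion (φ : ℂ → ℂ) : ℂ → ℂ := fun w => φ (-1 / w)

/-- The embedding of the extended real line into the Riemann sphere. -/
def extReal : OnePoint ℝ → OnePoint ℂ := OnePoint.map (fun x : ℝ => (x : ℂ))

/-- `φ` is defined and holomorphic on a boundary neighbourhood `U ∩ ℂ_±` of `S ± i0`, with `U` an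
open neighbourhood of `S` in the Riemann sphere. -/
def HolomorphicNear (σ : Side) (S : Set (OnePoint ℝ)) (φ : ℂ → ℂ) : Prop :=
  ∃ U : Set (OnePoint ℂ), IsOpen U ∧ extReal '' S ⊆ U ∧
    DifferentiableOn ℂ φ ({z : ℂ | (z : OnePoint ℂ) ∈ U} ∩ σ.halfPlane)

/-- `(Im z) φ z` is bounded on `U' ∩ ℂ_±` for some neighbourhood `U'` of the real point `s`. -/
def BehavesSimplyAtReal (σ : Side) (φ : ℂ → ℂ) (s : ℝ) : Prop :=
  ∃ U' ∈ 𝓝 (s : ℂ), ∃ C : ℝ, ∀ z ∈ U' ∩ σ.halfPlane, ‖(z.im : ℂ) * φ z‖ ≤ C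

/-- `φ` behaves simply at `s ± i0`, for `s` in the extended real line; at `∞` this refers to the
inversion of `φ` at `0`. -/
def BehavesSimplyAt (σ : Side) (φ : ℂ → ℂ) : OnePoint ℝ → Prop
  | .infty => BehavesSimplyAtReal σ (inversion φ) 0
  | .some s => BehavesSimplyAtReal σ φ s

/-- `φ` is holomorphic on a boundary neighbourhood of `S ± i0` and behaves simply on `S ± i0`. -/
def BehavesSimplyOn (σ : Side) (S : Set (OnePoint ℝ)) (φ : ℂ → ℂ) : Prop :=
  HolomorphicNear σ S φ ∧ ∀ s ∈ S, BehavesSimplyAt σ φ s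

/-! ### Test functions on the line and boundary limits -/

/-- The distributions on `ℝ`. -/
abbrev LineDistribution : Type := 𝓓((⊤ : Opens ℝ), ℂ) →L[ℂ] ℂ

/-- `T` is the boundary limit `φ (x ± i0) = lim_{y → +0} φ (x ± i y)`, as a distribution on `ℝ`. -/
def IsBoundaryLimit (σ : Side) (φ : ℂ → ℂ) (T : LineDistribution) : Prop :=
  ∀ f : 𝓓((⊤ : Opens ℝ), ℂ),
    Tendsto (fun y : ℝ => ∫ x : ℝ, f x * φ ((x : ℂ) + ((σ.sign * y : ℝ) : ℂ) * Complex.I))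
      (𝓝[>] 0) (𝓝 (T f))

/-- `ℝ ∖ {0}`. -/
def puncturedLine : Opens ℝ := ⟨{0}ᶜ, isOpen_compl_singleton⟩

/-- The test function `x ↦ f x / (1 + x ^ 2)`. -/
def weighted (f : 𝓓((⊤ : Opens ℝ), ℂ)) : 𝓓((⊤ : Opens ℝ), ℂ) where
  toFun x := f x / ((1 + x ^ 2 : ℝ) : ℂ)
  contDiff' := by
    have h : ContDiff ℝ ∞ (fun x : ℝ => ((1 + x ^ 2 : ℝ) : ℂ)) :=
      Complex.ofRealCLM.contDiff.comp (f := fun x : ℝ => 1 + x ^ 2)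
        (contDiff_const.add (contDiff_id.pow 2))
    have h0 : ∀ x : ℝ, ((1 + x ^ 2 : ℝ) : ℂ) ≠ 0 := fun x => by
      exact_mod_cast (by positivity : (1 + x ^ 2 : ℝ) ≠ 0)
    have h1 : ContDiff ℝ ∞ (fun x : ℝ => (((1 + x ^ 2 : ℝ) : ℂ))⁻¹) := h.inv h0
    simpa only [div_eq_mul_inv] using f.contDiff.mul h1
  hasCompactSupport' := by
    have h := f.hasCompactSupport.mul_right (f' := fun x : ℝ => (((1 + x ^ 2 : ℝ) : ℂ))⁻¹)
    simp only [div_eq_mul_inv]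
    exact h
  tsupport_subset' := by simp

/-- A test function on `ℝ ∖ {0}`, as a test function on `ℝ`. -/
def toLine (f : 𝓓(puncturedLine, ℂ)) : 𝓓((⊤ : Opens ℝ), ℂ) where
  toFun := f
  contDiff' := f.contDiff
  hasCompactSupport' := f.hasCompactSupport
  tsupport_subset' := by simp

theorem contDiffAt_negInv {f : ℝ → ℂ} (hf : ContDiff ℝ ∞ f) {x : ℝ} (hx : x ≠ 0) :
    ContDiffAt ℝ ∞ (fun x : ℝ => f (-1 / x)) x :=
  hf.contDiffAt.comp x (contDiffAt_const.div contDiffAt_id hx)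

theorem negInv_eventually_zero {f : ℝ → ℂ} (hf : HasCompactSupport f) :
    ∀ᶠ x : ℝ in 𝓝 0, x ≠ 0 → f (-1 / x) = 0 := by
  obtain ⟨R, hR⟩ := hf.isCompact.isBounded.subset_closedBall 0
  have hpos : (0 : ℝ) < 1 / (|R| + 1) := by positivity
  filter_upwards [Metric.ball_mem_nhds (0 : ℝ) hpos] with x hx hx0
  by_contra hne
  have h1 := hR (subset_tsupport f hne)
  rw [mem_closedBall_zero_iff, norm_div, norm_neg, norm_one, Real.norm_eq_abs,
    div_le_iff₀ (abs_pos.2 hx0)] at h1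
  rw [mem_ball_zero_iff, Real.norm_eq_abs, lt_div_iff₀ (by positivity)] at hx
  nlinarith [le_abs_self R, abs_pos.2 hx0]

/-- The inverted test function `x ↦ f (-1 / x)` of a test function `f` on `ℝ ∖ {0}`. The value at
`x = 0` is `f 0 = 0`. -/
def inverted (f : 𝓓(puncturedLine, ℂ)) : 𝓓(puncturedLine, ℂ) :=
  have hzero : f 0 = 0 := image_eq_zero_of_notMem_tsupport fun h => f.tsupport_subset h rfl
  have hsub : tsupport (fun x : ℝ => f (-1 / x)) ⊆ (fun x : ℝ => -1 / x) '' tsupport f := by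
    have hc : IsCompact ((fun x : ℝ => -1 / x) '' tsupport f) :=
      f.hasCompactSupport.isCompact.image_of_continuousOn
        (continuousOn_const.div continuousOn_id fun x hx => f.tsupport_subset hx)
    refine closure_minimal (fun x hx => ⟨-1 / x, subset_tsupport f hx, ?_⟩) hc.isClosed
    rcases eq_or_ne x 0 with rfl | h
    · simp
    · field_simp
  { toFun := fun x => f (-1 / x)
    contDiff' := by
      refine contDiff_iff_contDiffAt.2 fun x => ?_
      rcases eq_or_ne x 0 with rfl | hx
      · refine (contDiffAt_const (c := (0 : ℂ))).congr_of_eventuallyEq ?_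
        filter_upwards [negInv_eventually_zero f.hasCompactSupport] with x hx
        rcases eq_or_ne x 0 with rfl | h
        · simpa using hzero
        · exact hx h
      · exact contDiffAt_negInv f.contDiff hx
    hasCompactSupport' :=
      (f.hasCompactSupport.isCompact.image_of_continuousOn
        (continuousOn_const.div continuousOn_id fun x hx => f.tsupport_subset hx)).of_isClosed_subset
        (isClosed_tsupport _) hsub
    tsupport_subset' := by
      intro x hx
      obtain ⟨u, hu, rfl⟩ := hsub hx
      have hu0 : u ≠ 0 := f.tsupport_subset hu
      exact div_ne_zero (by norm_num) hu0 }

/-! ### Smooth functions and distributions on the extended real line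

The extended real line is the smooth manifold with the two charts `x` on `ℝ` and `-1 / x` on the
complement of `0`. -/

/-- The inversion `x ↦ -1 / x` of the extended real line. -/
def negInv : OnePoint ℝ → OnePoint ℝ
  | .infty => ((0 : ℝ) : OnePoint ℝ)
  | .some x => if x = 0 then OnePoint.infty else ((-1 / x : ℝ) : OnePoint ℝ)

theorem negInv_negInv (x : OnePoint ℝ) : negInv (negInv x) = x := by
  induction x using OnePoint.rec with
  | infty => simp [negInv]
  | coe x =>
    by_cases h : x = 0
    · simp [negInv, h]
    · simp [negInv, h]

/-- `C^∞` functions on the extended real line: smooth in both charts. -/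
def SmoothExt : Submodule ℂ (OnePoint ℝ → ℂ) where
  carrier := {f | ContDiff ℝ ∞ (fun x : ℝ => f x) ∧ ContDiff ℝ ∞ (fun x : ℝ => f (negInv x))}
  add_mem' hf hg := ⟨hf.1.add hg.1, hf.2.add hg.2⟩
  zero_mem' := ⟨contDiff_const, contDiff_const⟩
  smul_mem' _ _ hf := ⟨contDiff_const.smul hf.1, contDiff_const.smul hf.2⟩

/-- The inverted function `x ↦ f (-1 / x)` of a smooth function on the extended real line. -/
def SmoothExt.inverted (f : SmoothExt) : SmoothExt :=
  ⟨fun x => f.1 (negInv x), f.2.2, by simpa only [negInv_negInv] using f.2.1⟩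

/-- The extension by `0` at `∞` of a test function on `ℝ`. -/
def extendByZero (f : 𝓓((⊤ : Opens ℝ), ℂ)) : SmoothExt :=
  ⟨fun x => x.elim 0 f, f.contDiff, by
    refine contDiff_iff_contDiffAt.2 fun x => ?_
    rcases eq_or_ne x 0 with rfl | hx
    · refine (contDiffAt_const (c := (0 : ℂ))).congr_of_eventuallyEq ?_
      filter_upwards [negInv_eventually_zero f.hasCompactSupport] with x hx
      rcases eq_or_ne x 0 with rfl | h
      · simp [negInv]
      · simpa [negInv, h] using hx h
    · refine (contDiffAt_negInv f.contDiff hx).congr_of_eventuallyEq ?_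
      filter_upwards [isOpen_ne.mem_nhds hx] with y hy
      have hy : y ≠ 0 := hy
      simp [negInv, hy]⟩

/-- A linear functional on `C^∞` functions of the (compact) extended real line is a distribution if
it is bounded by the maximum of finitely many derivatives in the two charts; the parts `[-1, 1]` of
the charts cover the extended real line. -/
def IsExtDistribution (J : SmoothExt →ₗ[ℂ] ℂ) : Prop :=
  ∃ (k : ℕ) (C : ℝ), ∀ (f : SmoothExt) (M : ℝ),
    (∀ j ≤ k, ∀ x ∈ Icc (-1 : ℝ) 1,
      ‖iteratedDeriv j (fun x : ℝ => f.1 x) x‖ ≤ M ∧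
      ‖iteratedDeriv j (fun x : ℝ => f.1 (negInv x)) x‖ ≤ M) →
    ‖J f‖ ≤ C * M

/-- The distribution `J` on the extended real line is glued from `T / (1 + x ^ 2)` on `ℝ` and the
inversion of `T' / (1 + x ^ 2)` on the complement of `0`. -/
def IsGluing (T T' : LineDistribution) (J : SmoothExt →ₗ[ℂ] ℂ) : Prop :=
  IsExtDistribution J ∧
    (∀ f : 𝓓((⊤ : Opens ℝ), ℂ), J (extendByZero f) = T (weighted f)) ∧
    (∀ f : 𝓓((⊤ : Opens ℝ), ℂ), J (SmoothExt.inverted (extendByZero f)) = T' (weighted f))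

/-! ### Smooth functions and distributions on the circle -/

/-- `C^∞` functions on the unit circle, as `2π`-periodic smooth functions of the angle. -/
def SmoothCircle : Submodule ℂ (ℝ → ℂ) where
  carrier := {g | ContDiff ℝ ∞ g ∧ Function.Periodic g (2 * π)}
  add_mem' hf hg := ⟨hf.1.add hg.1, hf.2.add hg.2⟩
  zero_mem' := ⟨contDiff_const, fun _ => rfl⟩
  smul_mem' c _ hf := ⟨contDiff_const.smul hf.1, hf.2.smul c⟩

/-- A linear functional on `C^∞` functions of the circle is a distribution if it is bounded by the
maximum of finitely many derivatives. -/
def IsCircleDistribution (B : SmoothCircle →ₗ[ℂ] ℂ) : Prop :=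
  ∃ (k : ℕ) (C : ℝ), ∀ (g : SmoothCircle) (M : ℝ),
    (∀ j ≤ k, ∀ t ∈ Icc (-π) π, ‖iteratedDeriv j g.1 t‖ ≤ M) → ‖B g‖ ≤ C * M

/-- The Möbius transform `z ↦ -i φ (i (1 - z) / (1 + z))` of `φ`. -/
def moebiusTransform (φ : ℂ → ℂ) : ℂ → ℂ :=
  fun z => -Complex.I * φ (Complex.I * (1 - z) / (1 + z))

/-- `B` is the boundary limit `ϕ (e^{it ∓ 0}) = lim_{r → 1 ∓ 0} ϕ (r e^{it})`, as a distribution on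
the circle (`r → 1 - 0` for `upper`, `r → 1 + 0` for `lower`). -/
def IsCircleBoundaryLimit (σ : Side) (ϕ : ℂ → ℂ) (B : SmoothCircle →ₗ[ℂ] ℂ) : Prop :=
  IsCircleDistribution B ∧
    ∀ g : SmoothCircle,
      Tendsto (fun r : ℝ => ∫ t in (-π)..π, g.1 t * ϕ ((r : ℂ) * Complex.exp (t * Complex.I)))
        σ.radius (𝓝 (B g))

/-- The point `tan (t / 2)` of the extended real line, with value `∞` if `t ∈ π + 2πℤ`. -/
def tanHalf (t : ℝ) : OnePoint ℝ :=
  if Real.cos (t / 2) = 0 then OnePoint.infty else ((Real.tan (t / 2) : ℝ) : OnePoint ℝ)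

theorem negInv_tanHalf_add_pi (t : ℝ) : negInv (tanHalf (t + π)) = tanHalf t := by
  have h1 : (t + π) / 2 = t / 2 + π / 2 := by ring
  have hc : Real.cos ((t + π) / 2) = -Real.sin (t / 2) := by rw [h1, Real.cos_add_pi_div_two]
  have hs : Real.sin ((t + π) / 2) = Real.cos (t / 2) := by rw [h1, Real.sin_add_pi_div_two]
  have hsq := Real.sin_sq_add_cos_sq (t / 2)
  by_cases h : Real.sin (t / 2) = 0
  · have h' : Real.cos (t / 2) ≠ 0 := fun h0 => by simp [h, h0] at hsq
    simp [tanHalf, hc, h, h', negInv, Real.tan_eq_sin_div_cos]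
  · by_cases h' : Real.cos (t / 2) = 0
    · simp [tanHalf, hc, hs, h, h', negInv, Real.tan_eq_sin_div_cos]
    · have : Real.tan ((t + π) / 2) ≠ 0 := by
        rw [Real.tan_eq_sin_div_cos, hc, hs]; exact div_ne_zero h' (neg_ne_zero.2 h)
      simp only [tanHalf, hc, neg_eq_zero, h, h', if_false, negInv, this]
      rw [Real.tan_eq_sin_div_cos, Real.tan_eq_sin_div_cos, hc, hs]
      congr 1
      field_simp

theorem contDiffAt_comp_tanHalf {f : OnePoint ℝ → ℂ} (hf : ContDiff ℝ ∞ (fun x : ℝ => f x)) {t : ℝ}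
    (ht : Real.cos (t / 2) ≠ 0) : ContDiffAt ℝ ∞ (fun t => f (tanHalf t)) t := by
  have h2 : ContDiffAt ℝ ∞ (fun t : ℝ => Real.tan (t / 2)) t :=
    (Real.contDiffAt_tan.2 ht).comp t (f := fun t : ℝ => t / 2) (contDiffAt_id.div_const 2)
  refine (hf.contDiffAt.comp t h2).congr_of_eventuallyEq ?_
  have hcont : Continuous fun t : ℝ => Real.cos (t / 2) := by fun_prop
  filter_upwards [(isOpen_ne_fun hcont continuous_const).mem_nhds ht] with u hu
  have hu : Real.cos (u / 2) ≠ 0 := hu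
  simp [tanHalf, hu]

/-- The function `t ↦ f (tan (t / 2))` on the circle, for a smooth function `f` on the extended real
line. -/
def pullback (f : SmoothExt) : SmoothCircle :=
  ⟨fun t => f.1 (tanHalf t), by
    refine contDiff_iff_contDiffAt.2 fun t => ?_
    by_cases ht : Real.cos (t / 2) = 0
    · have hs : Real.cos ((t + π) / 2) ≠ 0 := by
        have h1 : (t + π) / 2 = t / 2 + π / 2 := by ring
        rw [h1, Real.cos_add_pi_div_two]
        intro h
        have hsq := Real.sin_sq_add_cos_sq (t / 2)
        rw [neg_eq_zero] at h
        simp [h, ht] at hsq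
      have h2 := contDiffAt_comp_tanHalf (f := fun x => f.1 (negInv x)) f.2.2 hs
      have h3 : ContDiffAt ℝ ∞ (fun u : ℝ => u + π) t := by fun_prop
      have h4 := ContDiffAt.comp t h2 h3
      simpa only [Function.comp_def, negInv_tanHalf_add_pi] using h4
    · exact contDiffAt_comp_tanHalf f.2.1 ht, by
    intro t
    have h1 : tanHalf (t + 2 * π) = tanHalf t := by
      have : (t + 2 * π) / 2 = t / 2 + π := by ring
      simp only [tanHalf, this, Real.cos_add_pi, neg_eq_zero, Real.tan_add_pi]
    exact congrArg f.1 h1⟩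

end BoundaryDistribution

end

open BoundaryDistribution

namespace BoundaryDistribution

/-! ### Boundary neighbourhoods and inversion -/

/-! A function that grows at most like the inverse distance to the boundary is, up to the boundary,
a third derivative of a continuous function. By compactness of the extended line, `φ` is holomorphic
on a strip of uniform width (`HolomorphicNear.exists_strip`). Each integration there gains one power
of the distance, so a third primitive `Θ` is locally Lipschitz near the real line and extends
continuously to it (`BehavesSimplyOn.exists_isThirdPrimitive`).

Along any family of curves in the strip that degenerates to a real curve, three integrations by
parts move the derivatives onto the test function, and the limit passes under the integral
(`IsThirdPrimitive.tendsto_integral`). The limit depends only on the limiting curve and on the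
derivation along it. Horizontal lines give `φ (x ± i0)`. The curves `tan ((t ± i y) / 2)` are the
images of the circles of radius `exp (∓ y)`; for test functions supported away from `t = π` they
have the same limit as the horizontal lines reparametrized by `x = tan (t / 2)`, and `dt = 2 dx / (1
+ x ^ 2)` gives the factor 2 (`IsThirdPrimitive.tendsto_circleMean_pullback`).

Rotation of the circle by `π` is the inversion `w ↦ -1 / w`, under which the hypothesis is stable. A
partition of unity therefore reduces the whole circle to the case above, for `φ` and for its
inversion. This yields the circle distribution `B` (`exists_circle_functional`), and `J` is its pull
back times `i / 2`. Agreement of the two line distributions on the overlap is read off from the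
existence of `J`; uniqueness is a partition of unity on the extended line. -/

theorem Side.sign_mul_sign (σ : Side) : σ.sign * σ.sign = 1 := by cases σ <;> norm_num [Side.sign]

theorem Side.abs_sign (σ : Side) : |σ.sign| = 1 := by cases σ <;> norm_num [Side.sign]

theorem Side.sign_ne_zero (σ : Side) : σ.sign ≠ 0 := by cases σ <;> norm_num [Side.sign]

theorem Side.abs_im_of_pos {σ : Side} {z : ℂ} (h : 0 < σ.sign * z.im) : |z.im| = σ.sign * z.im := by
  rw [← abs_of_pos h, abs_mul, σ.abs_sign, one_mul]

theorem Side.isOpen_halfPlane (σ : Side) : IsOpen σ.halfPlane :=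
  isOpen_lt continuous_const (continuous_const.mul Complex.continuous_im)

theorem Side.ne_zero_of_mem_halfPlane {σ : Side} {z : ℂ} (hz : z ∈ σ.halfPlane) : z ≠ 0 := by
  rintro rfl
  simp [Side.halfPlane] at hz

theorem im_neg_one_div (z : ℂ) : (-1 / z).im = z.im / Complex.normSq z := by
  simp [neg_div, Complex.inv_im]

theorem Side.neg_one_div_mem_halfPlane {σ : Side} {z : ℂ} (hz : z ∈ σ.halfPlane) :
    -1 / z ∈ σ.halfPlane := by
  have h0 := Complex.normSq_pos.2 (Side.ne_zero_of_mem_halfPlane hz)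
  simp only [Side.halfPlane, mem_ofPred_eq, im_neg_one_div] at hz ⊢
  rw [← mul_div_assoc]
  exact div_pos hz h0

theorem neg_one_div_neg_one_div (z : ℂ) : -1 / (-1 / z) = z := by
  rcases eq_or_ne z 0 with rfl | h
  · simp
  · field_simp

theorem inversion_inversion (φ : ℂ → ℂ) : inversion (inversion φ) = φ := by
  funext z
  simp [inversion]

/-- An open set of the sphere that contains `∞` is the complement of a compact set `K` of the plane.
This form makes both the inversion of the domain and the uniform distance from the real line
immediate. -/
theorem holomorphicNear_univ_iff {σ : Side} {φ : ℂ → ℂ} :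
    HolomorphicNear σ univ φ ↔ ∃ K : Set ℂ, IsCompact K ∧ (∀ z ∈ K, z.im ≠ 0) ∧
      DifferentiableOn ℂ φ (Kᶜ ∩ σ.halfPlane) := by
  constructor
  · rintro ⟨U, hU, hS, hd⟩
    have hinf : OnePoint.infty ∈ U := hS ⟨OnePoint.infty, trivial, rfl⟩
    refine ⟨((↑) ⁻¹' U : Set ℂ)ᶜ, ((OnePoint.isOpen_iff_of_mem hinf).1 hU).2, ?_, ?_⟩
    · intro z hz h0
      refine hz (hS ⟨((z.re : ℝ) : OnePoint ℝ), trivial, ?_⟩)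
      change (((z.re : ℝ) : ℂ) : OnePoint ℂ) = z
      congr 1
      exact Complex.ext (by simp) (by simp [h0])
    · rwa [compl_compl]
  · rintro ⟨K, hK, h0, hd⟩
    refine ⟨((↑) '' K : Set (OnePoint ℂ))ᶜ, OnePoint.isOpen_compl_image_coe.2 ⟨hK.isClosed, hK⟩,
      ?_, hd.mono ?_⟩
    · rintro _ ⟨x, -, rfl⟩ ⟨z, hz, hzx⟩
      induction x using OnePoint.rec with
      | infty => exact OnePoint.coe_ne_infty z hzx
      | coe x =>
        have : z = (x : ℂ) := OnePoint.coe_injective hzx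
        exact h0 z hz (by simp [this])
    · rintro z ⟨hz, hz'⟩
      exact ⟨fun h => hz ⟨z, h, rfl⟩, hz'⟩

theorem HolomorphicNear.inversion {σ : Side} {φ : ℂ → ℂ} (h : HolomorphicNear σ univ φ) :
    HolomorphicNear σ univ (inversion φ) := by
  obtain ⟨K, hK, h0, hd⟩ := holomorphicNear_univ_iff.1 h
  have hne : ∀ z ∈ K, z ≠ 0 := fun z hz hz0 => h0 z hz (by simp [hz0])
  refine holomorphicNear_univ_iff.2 ⟨(fun z => -1 / z) '' K,
    hK.image_of_continuousOn (continuousOn_const.div continuousOn_id hne), ?_, ?_⟩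
  · rintro _ ⟨z, hz, rfl⟩
    simp only [im_neg_one_div]
    exact div_ne_zero (h0 z hz) (by simpa using hne z hz)
  · refine hd.comp (t := Kᶜ ∩ σ.halfPlane) (f := fun z => -1 / z) ?_ ?_
    · exact (differentiableOn_const _).div differentiableOn_id
        fun z hz => Side.ne_zero_of_mem_halfPlane hz.2
    · rintro z ⟨hz, hz'⟩
      exact ⟨fun hm => hz ⟨_, hm, neg_one_div_neg_one_div z⟩, Side.neg_one_div_mem_halfPlane hz'⟩

/-- Since `Im (-1 / z) = Im z / |z| ^ 2`, the two products differ by the factor `|z| ^ 2`, which is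
at most `(|s| + 1) ^ 2` on the unit ball about `s`. -/
theorem BehavesSimplyAtReal.inversion {σ : Side} {φ : ℂ → ℂ} {s : ℝ} (hs : s ≠ 0)
    (h : BehavesSimplyAtReal σ φ (-1 / s)) : BehavesSimplyAtReal σ (inversion φ) s := by
  obtain ⟨U, hU, C, hC⟩ := h
  have hsC : (s : ℂ) ≠ 0 := by exact_mod_cast hs
  have hcont : ContinuousAt (fun z : ℂ => -1 / z) (s : ℂ) :=
    continuousAt_const.div continuousAt_id hsC
  have hU' : (fun z : ℂ => -1 / z) ⁻¹' U ∈ 𝓝 (s : ℂ) := hcont (by simpa using hU)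
  refine ⟨_, inter_mem hU' (Metric.ball_mem_nhds (s : ℂ) one_pos), C * (|s| + 1) ^ 2, ?_⟩
  rintro z ⟨⟨hz, hzb⟩, hzσ⟩
  have hz0 := Side.ne_zero_of_mem_halfPlane hzσ
  have h1 := hC _ ⟨hz, Side.neg_one_div_mem_halfPlane hzσ⟩
  have hC0 : 0 ≤ C := (norm_nonneg _).trans h1
  have h2 : ‖z‖ ≤ |s| + 1 := by
    have := norm_le_norm_add_norm_sub' z (s : ℂ)
    rw [Metric.mem_ball, dist_eq_norm] at hzb
    simp only [Complex.norm_real, Real.norm_eq_abs] at this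
    linarith
  rw [im_neg_one_div] at h1
  have h3 : (z.im : ℂ) * BoundaryDistribution.inversion φ z =
      (((z.im / Complex.normSq z : ℝ) : ℂ) * φ (-1 / z)) * ((‖z‖ ^ 2 : ℝ) : ℂ) := by
    have : ((Complex.normSq z : ℝ) : ℂ) ≠ 0 := by simpa using hz0
    rw [← Complex.normSq_eq_norm_sq, BoundaryDistribution.inversion]
    push_cast
    field_simp
  rw [h3, norm_mul, Complex.norm_real, Real.norm_of_nonneg (by positivity)]
  gcongr

theorem BehavesSimplyOn.inversion {σ : Side} {φ : ℂ → ℂ} (h : BehavesSimplyOn σ univ φ) :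
    BehavesSimplyOn σ univ (inversion φ) := by
  refine ⟨h.1.inversion, fun s _ => ?_⟩
  induction s using OnePoint.rec with
  | infty =>
    change BehavesSimplyAtReal σ (BoundaryDistribution.inversion _) 0
    rw [inversion_inversion]
    exact h.2 ((0 : ℝ) : OnePoint ℝ) trivial
  | coe s =>
    change BehavesSimplyAtReal σ _ s
    rcases eq_or_ne s 0 with rfl | hs
    · exact h.2 OnePoint.infty trivial
    · exact BehavesSimplyAtReal.inversion hs (h.2 ((-1 / s : ℝ) : OnePoint ℝ) trivial)

/-! ### Strips along the real line -/

/-- The open strip of width `δ` along the real line. -/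
def strip (σ : Side) (δ : ℝ) : Set ℂ := {z | 0 < σ.sign * z.im ∧ σ.sign * z.im < δ}

/-- The strip of width `δ` along the real line, including the real line. -/
def closedStrip (σ : Side) (δ : ℝ) : Set ℂ := {z | 0 ≤ σ.sign * z.im ∧ σ.sign * z.im < δ}

theorem strip_subset_closedStrip (σ : Side) (δ : ℝ) : strip σ δ ⊆ closedStrip σ δ :=
  fun _ hz => ⟨hz.1.le, hz.2⟩

theorem isOpen_strip (σ : Side) (δ : ℝ) : IsOpen (strip σ δ) :=
  σ.isOpen_halfPlane.inter (isOpen_lt (continuous_const.mul Complex.continuous_im) continuous_const)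

theorem convex_strip (σ : Side) (δ : ℝ) : Convex ℝ (strip σ δ) := by
  have : strip σ δ = (fun z : ℂ => σ.sign * z.im) ⁻¹' Ioo 0 δ := rfl
  rw [this]
  exact (convex_Ioo 0 δ).is_linear_preimage
    ⟨fun x y => by simp [mul_add], fun c x => by simp; ring⟩

/-- The excluded compact set has no real point, so `|Im z|` has a positive minimum on it. -/
theorem HolomorphicNear.exists_strip {σ : Side} {φ : ℂ → ℂ} (h : HolomorphicNear σ univ φ) :
    ∃ δ > 0, DifferentiableOn ℂ φ (strip σ δ) := by
  obtain ⟨K, hK, h0, hd⟩ := holomorphicNear_univ_iff.1 h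
  rcases K.eq_empty_or_nonempty with rfl | hne
  · exact ⟨1, one_pos, hd.mono fun z hz => ⟨by simp, hz.1⟩⟩
  · obtain ⟨z₀, hz₀, hmin⟩ := hK.exists_isMinOn hne
      (continuous_abs.comp Complex.continuous_im).continuousOn
    refine ⟨|z₀.im|, abs_pos.2 (h0 _ hz₀), hd.mono fun z hz => ⟨fun hzK => ?_, hz.1⟩⟩
    have h1 : |z₀.im| ≤ |z.im| := hmin hzK
    rw [Side.abs_im_of_pos hz.1] at h1
    exact absurd hz.2 (not_lt.2 h1)

/-- Near every bounded part of the real line, `f` is bounded by a multiple of the power `p` of the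
distance to the real line. -/
def LocallyBoundedByPow (σ : Side) (f : ℂ → ℂ) (p : ℝ) : Prop :=
  ∀ R : ℝ, ∃ C ≥ 0, ∃ η > 0, ∀ z : ℂ, |z.re| ≤ R → 0 < σ.sign * z.im → σ.sign * z.im < η →
    ‖f z‖ ≤ C * (σ.sign * z.im) ^ p

theorem BehavesSimplyOn.locallyBoundedByPow {σ : Side} {φ : ℂ → ℂ} (h : BehavesSimplyOn σ univ φ) :
    LocallyBoundedByPow σ φ (-1) := by
  intro R
  have key : ∃ W : Set ℂ, IsOpen W ∧ (fun x : ℝ => (x : ℂ)) '' Icc (-R) R ⊆ W ∧ ∃ C ≥ (0 : ℝ),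
      ∀ z ∈ W ∩ σ.halfPlane, ‖(z.im : ℂ) * φ z‖ ≤ C := by
    refine isCompact_Icc.induction_on (p := fun S => ∃ W : Set ℂ, IsOpen W ∧
      (fun x : ℝ => (x : ℂ)) '' S ⊆ W ∧ ∃ C ≥ (0 : ℝ),
      ∀ z ∈ W ∩ σ.halfPlane, ‖(z.im : ℂ) * φ z‖ ≤ C) ?_ ?_ ?_ ?_
    · exact ⟨∅, isOpen_empty, by simp, 0, le_rfl, by simp⟩
    · rintro s t hst ⟨W, hW, hW', hC⟩
      exact ⟨W, hW, (image_mono hst).trans hW', hC⟩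
    · rintro s t ⟨W, hW, hsW, C, hC0, hC⟩ ⟨W', hW', hsW', C', hC0', hC'⟩
      refine ⟨W ∪ W', hW.union hW', ?_, max C C', hC0.trans (le_max_left _ _), ?_⟩
      · rw [image_union]
        exact union_subset_union hsW hsW'
      · rintro z ⟨hz | hz, hzσ⟩
        · exact (hC z ⟨hz, hzσ⟩).trans (le_max_left _ _)
        · exact (hC' z ⟨hz, hzσ⟩).trans (le_max_right _ _)
    · intro x _
      obtain ⟨U, hU, C, hC⟩ := h.2 (x : OnePoint ℝ) trivial
      obtain ⟨W, hWU, hW, hxW⟩ := mem_nhds_iff.1 hU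
      refine ⟨(fun x : ℝ => (x : ℂ)) ⁻¹' W, mem_nhdsWithin_of_mem_nhds
        ((hW.preimage Complex.continuous_ofReal).mem_nhds hxW), W, hW, image_preimage_subset _ _,
        max C 0, le_max_right _ _, fun z hz => (hC z ⟨hWU hz.1, hz.2⟩).trans (le_max_left _ _)⟩
  obtain ⟨W, hW, hRW, C, hC0, hC⟩ := key
  obtain ⟨η, hη, hηW⟩ := (isCompact_Icc.image Complex.continuous_ofReal).exists_thickening_subset_open
    hW hRW
  refine ⟨C, hC0, η, hη, fun z hzR hz0 hzη => ?_⟩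
  have hzW : z ∈ W := by
    refine hηW (Metric.mem_thickening_iff.2 ⟨(z.re : ℂ), ⟨z.re, abs_le.1 hzR, rfl⟩, ?_⟩)
    rw [Complex.dist_of_re_eq (by simp), Complex.ofReal_im, Real.dist_eq, sub_zero,
      Side.abs_im_of_pos hz0]
    exact hzη
  have h1 := hC z ⟨hzW, hz0⟩
  rw [norm_mul, Complex.norm_real, Real.norm_eq_abs, Side.abs_im_of_pos hz0] at h1
  rw [Real.rpow_neg_one, ← div_eq_mul_inv, le_div_iff₀ hz0, mul_comm]
  exact h1

theorem LocallyBoundedByPow.mono {σ : Side} {f : ℂ → ℂ} {p q : ℝ} (hqp : q ≤ p)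
    (h : LocallyBoundedByPow σ f p) : LocallyBoundedByPow σ f q := by
  intro R
  obtain ⟨C, hC, η, hη, hb⟩ := h R
  refine ⟨C, hC, min η 1, lt_min hη one_pos, fun z hR h0 h1 => ?_⟩
  refine (hb z hR h0 (h1.trans_le (min_le_left _ _))).trans ?_
  gcongr C * ?_
  exact Real.rpow_le_rpow_of_exponent_ge h0 (h1.trans_le (min_le_right _ _)).le hqp

/-- A primitive of a function of growth `p - 1` has growth `min p 0`. -/
theorem LocallyBoundedByPow.primitive {σ : Side} {δ : ℝ} (hδ : 0 < δ) {f F : ℂ → ℂ} {p : ℝ}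
    (hp : p ≠ 0) (hF : ∀ z ∈ strip σ δ, HasDerivAt F (f z) z)
    (h : LocallyBoundedByPow σ f (p - 1)) : LocallyBoundedByPow σ F (min p 0) := by
  intro R
  obtain ⟨C, hC, η, hη, hb⟩ := h R
  -- The base height `u₀` is below `η` for the growth bound, below `δ` to stay in the strip, and
  -- below `1` so that powers can be compared.
  obtain ⟨u₀, hu₀, hu₀'⟩ := exists_between (lt_min (lt_min hη hδ) one_pos)
  have hu₀η : u₀ < η := hu₀'.trans_le ((min_le_left _ _).trans (min_le_left _ _))
  have hu₀δ : u₀ < δ := hu₀'.trans_le ((min_le_left _ _).trans (min_le_right _ _))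
  have hu₀1 : u₀ < 1 := hu₀'.trans_le (min_le_right _ _)
  let pt : ℝ → ℝ → ℂ := fun x u => (x : ℂ) + ((σ.sign * u : ℝ) : ℂ) * Complex.I
  have hpt_re : ∀ x u, (pt x u).re = x := fun x u => by simp [pt]
  have hpt_im : ∀ x u, σ.sign * (pt x u).im = u := fun x u => by
    simp [pt, ← mul_assoc, σ.sign_mul_sign]
  have hptS : ∀ x u, 0 < u → u < δ → pt x u ∈ strip σ δ := fun x u h0 h1 =>
    ⟨by rwa [hpt_im], by rwa [hpt_im]⟩
  have hbase : ∃ A, ∀ x ∈ Icc (-R) R, ‖F (pt x u₀)‖ ≤ A := by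
    refine isCompact_Icc.exists_bound_of_continuousOn (ContinuousOn.comp (t := strip σ δ)
      (fun z hz => (hF z hz).continuousAt.continuousWithinAt) (by fun_prop)
      fun x _ => hptS x u₀ hu₀ hu₀δ)
  obtain ⟨A, hA⟩ := hbase
  refine ⟨|A| + 2 * (C / |p|), by positivity, u₀, hu₀, fun z hzR hz0 hzu => ?_⟩
  set u := σ.sign * z.im with hu
  have hz : z = pt z.re u := by
    apply Complex.ext
    · simp [pt]
    · simp [pt, hu, ← mul_assoc, σ.sign_mul_sign]
  -- Integration of the growth bound down the vertical segment; `v` is the descent from height `u₀`.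
  -- The majorant is an antiderivative of `C (u₀ - v) ^ (p - 1)`, valid for either sign of `p`.
  have hmv : ‖F (pt z.re u) - F (pt z.re u₀)‖ ≤ C / p * (u₀ ^ p - u ^ p) := by
    have := image_norm_le_of_norm_deriv_right_le_deriv_boundary'
      (f := fun v : ℝ => F (pt z.re (u₀ - v)) - F (pt z.re u₀))
      (f' := fun v : ℝ => f (pt z.re (u₀ - v)) * (-(σ.sign : ℂ) * Complex.I)) (a := 0) (b := u₀ - u)
      (B := fun v : ℝ => C / p * (u₀ ^ p - (u₀ - v) ^ p))
      (B' := fun v : ℝ => C * (u₀ - v) ^ (p - 1)) ?_ ?_ ?_ ?_ ?_ ?_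
      (x := u₀ - u) ⟨by linarith, le_rfl⟩
    · simpa using this
    · intro v hv
      have hS : pt z.re (u₀ - v) ∈ strip σ δ := hptS _ _ (by linarith [hv.2]) (by linarith [hv.1])
      refine ContinuousAt.continuousWithinAt ?_
      refine ContinuousAt.sub ?_ continuousAt_const
      exact ContinuousAt.comp (f := fun v : ℝ => pt z.re (u₀ - v)) (hF _ hS).continuousAt
        (by simp only [pt]; fun_prop)
    · intro v hv
      have hS : pt z.re (u₀ - v) ∈ strip σ δ := hptS _ _ (by linarith [hv.2]) (by linarith [hv.1])
      refine HasDerivAt.hasDerivWithinAt (HasDerivAt.sub_const _ ?_)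
      refine HasDerivAt.comp (h := fun v : ℝ => pt z.re (u₀ - v)) v (hF _ hS) ?_
      have h1 : HasDerivAt (fun v : ℝ => σ.sign * (u₀ - v)) (σ.sign * (-1)) v :=
        ((hasDerivAt_id v).const_sub u₀).const_mul _
      have h2 := (h1.ofReal_comp.mul_const Complex.I).const_add (z.re : ℂ)
      exact h2.congr_deriv (by push_cast; ring)
    · simp
    · refine ContinuousOn.mul continuousOn_const (continuousOn_const.sub ?_)
      exact (by fun_prop : ContinuousOn (fun v : ℝ => u₀ - v) _).rpow_const
        fun v hv => Or.inl (by linarith [hv.2])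
    · intro v hv
      have hne : u₀ - v ≠ 0 := by linarith [hv.2]
      have h1 : HasDerivAt (fun v : ℝ => u₀ - v) (-1) v := (hasDerivAt_id v).const_sub u₀
      have h2 := ((h1.rpow_const (p := p) (Or.inl hne)).const_sub (u₀ ^ p)).const_mul (C / p)
      refine HasDerivAt.hasDerivWithinAt ?_
      exact h2.congr_deriv (by field_simp)
    · intro v hv
      rw [norm_mul, norm_mul, norm_neg, Complex.norm_real, Real.norm_eq_abs, σ.abs_sign,
        Complex.norm_I, mul_one, mul_one]
      have := hb (pt z.re (u₀ - v)) (by rwa [hpt_re]) (by rw [hpt_im]; linarith [hv.2])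
        (by rw [hpt_im]; linarith [hv.1])
      rwa [hpt_im] at this
  have hu1 : u < 1 := hzu.trans hu₀1
  have hmono : ∀ w, u ≤ w → w < 1 → w ^ p ≤ u ^ min p 0 := by
    intro w huw hw1
    calc w ^ p ≤ w ^ min p 0 :=
          Real.rpow_le_rpow_of_exponent_ge (hz0.trans_le huw) hw1.le (min_le_left _ _)
      _ ≤ u ^ min p 0 := Real.rpow_le_rpow_of_nonpos hz0 huw (min_le_right _ _)
  have hone : 1 ≤ u ^ min p 0 :=
    Real.one_le_rpow_of_pos_of_le_one_of_nonpos hz0 hu1.le (min_le_right _ _)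
  have h3 : C / p * (u₀ ^ p - u ^ p) ≤ C / |p| * (2 * u ^ min p 0) := by
    calc C / p * (u₀ ^ p - u ^ p) ≤ |C / p * (u₀ ^ p - u ^ p)| := le_abs_self _
      _ = C / |p| * |u₀ ^ p - u ^ p| := by rw [abs_mul, abs_div, abs_of_nonneg hC]
      _ ≤ C / |p| * (2 * u ^ min p 0) := by
        gcongr
        have e1 := hmono u₀ hzu.le hu₀1
        have e2 := hmono u le_rfl hu1
        have e3 : 0 ≤ u₀ ^ p := Real.rpow_nonneg hu₀.le _
        have e4 : 0 ≤ u ^ p := Real.rpow_nonneg hz0.le _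
        rw [abs_le]
        constructor <;> linarith
  have h4 := hA z.re (abs_le.1 hzR)
  calc ‖F z‖ = ‖F (pt z.re u)‖ := by rw [← hz]
    _ ≤ ‖F (pt z.re u₀)‖ + ‖F (pt z.re u) - F (pt z.re u₀)‖ := norm_le_norm_add_norm_sub' _ _
    _ ≤ |A| * u ^ min p 0 + C / |p| * (2 * u ^ min p 0) := by
      refine add_le_add ?_ (hmv.trans h3)
      exact (h4.trans (le_abs_self A)).trans (le_mul_of_one_le_right (abs_nonneg _) hone)
    _ = _ := by ring

/-- `Θ` is a continuous function on a strip including the real line, with third derivative `φ`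
inside. -/
structure IsThirdPrimitive (σ : Side) (δ : ℝ) (φ Θ : ℂ → ℂ) : Prop where
  pos : 0 < δ
  continuousOn : ContinuousOn Θ (closedStrip σ δ)
  exists_deriv : ∃ Φ F : ℂ → ℂ, (∀ z ∈ strip σ δ, HasDerivAt Θ (Φ z) z) ∧
    (∀ z ∈ strip σ δ, HasDerivAt Φ (F z) z) ∧ (∀ z ∈ strip σ δ, HasDerivAt F (φ z) z)
  holomorphic : DifferentiableOn ℂ φ (strip σ δ)

/-! ### Primitives that are continuous up to the real line -/

theorem exists_primitive_strip {σ : Side} {δ : ℝ} {f : ℂ → ℂ}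
    (hf : DifferentiableOn ℂ f (strip σ δ)) :
    ∃ F : ℂ → ℂ, ∀ z ∈ strip σ δ, HasDerivAt F (f z) z := by
  obtain ⟨F, hF⟩ := (convex_strip σ δ).exists_forall_hasDerivWithinAt hf
  exact ⟨F, fun z hz => (hF z hz).hasDerivAt ((isOpen_strip σ δ).mem_nhds hz)⟩

/-- Near a real point, the strip meets a small ball in a convex set with bounded derivative. There
`Θ` is Lipschitz, hence the restriction of a continuous function on the plane, whose value at `z₀`
is the limit. -/
theorem exists_tendsto_of_bounded_deriv {σ : Side} {δ : ℝ} {Θ Φ : ℂ → ℂ}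
    (hΘ : ∀ z ∈ strip σ δ, HasDerivAt Θ (Φ z) z) (hΦ : LocallyBoundedByPow σ Φ 0) {z₀ : ℂ}
    (hz₀ : z₀ ∈ closedStrip σ δ) : ∃ w, Tendsto Θ (𝓝[strip σ δ] z₀) (𝓝 w) := by
  rcases hz₀.1.eq_or_lt with h0 | h0
  · obtain ⟨C, hC, η, hη, hb⟩ := hΦ (|z₀.re| + 1)
    have him : z₀.im = 0 := by simpa [σ.sign_ne_zero] using h0.symm
    set S := strip σ δ ∩ Metric.ball z₀ (min 1 η) with hS
    have hconv : Convex ℝ S := (convex_strip σ δ).inter (convex_ball _ _)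
    have hbound : ∀ z ∈ S, ‖Φ z‖ ≤ C := by
      rintro z ⟨hz, hzb⟩
      rw [Metric.mem_ball, dist_eq_norm, lt_min_iff] at hzb
      have h1 := (Complex.abs_re_le_norm (z - z₀)).trans_lt hzb.1
      have h2 := (Complex.abs_im_le_norm (z - z₀)).trans_lt hzb.2
      rw [Complex.sub_im, him, sub_zero, Side.abs_im_of_pos hz.1] at h2
      rw [Complex.sub_re] at h1
      have h3 : |z.re| ≤ |z₀.re| + 1 := by
        have := abs_sub_abs_le_abs_sub z.re z₀.re
        linarith
      simpa using hb z h3 hz.1 h2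
    have hlip : LipschitzOnWith C.toNNReal Θ S :=
      hconv.lipschitzOnWith_of_nnnorm_hasDerivWithin_le
        (fun z hz => (hΘ z hz.1).hasDerivWithinAt) fun z hz => by
          rw [← NNReal.coe_le_coe, coe_nnnorm, Real.coe_toNNReal C hC]
          exact hbound z hz
    obtain ⟨g, hg, hgS⟩ := hlip.extend_finite_dimension
    refine ⟨g z₀, ((hg.continuous.tendsto z₀).mono_left nhdsWithin_le_nhds).congr' ?_⟩
    have hball : Metric.ball z₀ (min 1 η) ∈ 𝓝 z₀ := Metric.ball_mem_nhds _ (lt_min one_pos hη)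
    filter_upwards [self_mem_nhdsWithin, mem_nhdsWithin_of_mem_nhds hball] with z h1 h2
    exact (hgS ⟨h1, h2⟩).symm
  · exact ⟨Θ z₀, (hΘ z₀ ⟨h0, hz₀.2⟩).continuousAt.continuousWithinAt⟩

theorem closedStrip_subset_closure {σ : Side} {δ : ℝ} : closedStrip σ δ ⊆ closure (strip σ δ) := by
  intro z hz
  have hlim : Tendsto (fun v : ℝ => z + ((σ.sign * v : ℝ) : ℂ) * Complex.I) (𝓝[>] 0) (𝓝 z) := by
    have : Continuous fun v : ℝ => z + ((σ.sign * v : ℝ) : ℂ) * Complex.I := by fun_prop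
    simpa using (this.tendsto 0).mono_left nhdsWithin_le_nhds
  refine mem_closure_of_tendsto hlim ?_
  filter_upwards [Ioo_mem_nhdsGT (sub_pos.2 hz.2)] with v hv
  have him : σ.sign * (z + ((σ.sign * v : ℝ) : ℂ) * Complex.I).im = σ.sign * z.im + v := by
    simp [mul_add, ← mul_assoc, σ.sign_mul_sign]
  refine ⟨?_, ?_⟩ <;> rw [him]
  · linarith [hz.1, hv.1]
  · linarith [hv.2]

theorem BehavesSimplyOn.exists_isThirdPrimitive {σ : Side} {φ : ℂ → ℂ}
    (h : BehavesSimplyOn σ univ φ) : ∃ δ Θ, IsThirdPrimitive σ δ φ Θ := by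
  obtain ⟨δ, hδ, hd⟩ := h.1.exists_strip
  have hdiff : ∀ {f F : ℂ → ℂ}, (∀ z ∈ strip σ δ, HasDerivAt F (f z) z) →
      DifferentiableOn ℂ F (strip σ δ) :=
    fun hF z hz => (hF z hz).differentiableAt.differentiableWithinAt
  obtain ⟨F, hF⟩ := exists_primitive_strip hd
  obtain ⟨Φ, hΦ⟩ := exists_primitive_strip (hdiff hF)
  obtain ⟨Θ, hΘ⟩ := exists_primitive_strip (hdiff hΦ)
  -- Integrating the exponent `-1` would produce a logarithm. It is weakened to `-3/2`, so that the
  -- exponents of `φ`, `F`, `Φ` become `-3/2`, `-1/2`, `0`.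
  have b1 : LocallyBoundedByPow σ φ (-1 / 2 - 1) := h.locallyBoundedByPow.mono (by norm_num)
  have b2 := b1.primitive hδ (by norm_num) hF
  have b3 : LocallyBoundedByPow σ F (1 / 2 - 1) := b2.mono (by norm_num)
  have b4 : LocallyBoundedByPow σ Φ 0 := (b3.primitive hδ (by norm_num) hΦ).mono (by norm_num)
  have heq : ∀ z ∈ strip σ δ, extendFrom (strip σ δ) Θ z = Θ z :=
    extendFrom_extends (hdiff hΘ).continuousOn
  refine ⟨δ, extendFrom (strip σ δ) Θ, hδ, ?_, ⟨Φ, F, ?_, hΦ, hF⟩, hd⟩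
  · exact continuousOn_extendFrom closedStrip_subset_closure
      fun z hz => exists_tendsto_of_bounded_deriv hΘ b4 hz
  · intro z hz
    refine (hΘ z hz).congr_of_eventuallyEq ?_
    filter_upwards [(isOpen_strip σ δ).mem_nhds hz] with w hw using heq w hw

/-! ### Integration by parts along a family of curves -/

/-- The transpose `-(m g)'` of the derivation `m d/dt`. -/
noncomputable def transposeDeriv (m g : ℝ → ℂ) : ℝ → ℂ := fun t => -deriv (fun s => g s * m s) t

/-- The transpose of the cube of the derivation `m d/dt`. -/
noncomputable def transposeDeriv₃ (m g : ℝ → ℂ) : ℝ → ℂ :=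
  transposeDeriv m (transposeDeriv m (transposeDeriv m g))

/-- Joint smoothness in the parameter and the variable is what lets the transposed test functions
converge as the curves approach the boundary. -/
theorem contDiff_transposeDeriv_family {m g : ℝ → ℝ → ℂ}
    (hm : ContDiff ℝ ∞ (Function.uncurry m)) (hg : ContDiff ℝ ∞ (Function.uncurry g)) :
    ContDiff ℝ ∞ (Function.uncurry fun y => transposeDeriv (m y) (g y)) := by
  have h1 : ContDiff ℝ ∞ (Function.uncurry fun (p : ℝ × ℝ) (s : ℝ) => g p.1 s * m p.1 s) := by
    have e : ContDiff ℝ ∞ (fun q : (ℝ × ℝ) × ℝ => (q.1.1, q.2)) := by fun_prop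
    exact (hg.comp e).mul (hm.comp e)
  have h2 : ContDiff ℝ ∞ fun p : ℝ × ℝ => fderiv ℝ (fun s : ℝ => g p.1 s * m p.1 s) p.2 :=
    h1.fderiv contDiff_snd (by simp)
  exact (h2.clm_apply contDiff_const).neg

theorem contDiff_transposeDeriv {m g : ℝ → ℂ} (hm : ContDiff ℝ ∞ m) (hg : ContDiff ℝ ∞ g) :
    ContDiff ℝ ∞ (transposeDeriv m g) :=
  ((hg.mul hm).iterate_deriv 1).neg

/-- `g` vanishes at the points `t` with `r < |t| < r'`. -/
def VanishesBetween (r r' : ℝ) (g : ℝ → ℂ) : Prop := ∀ t, r < |t| → |t| < r' → g t = 0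

theorem VanishesBetween.transposeDeriv {r r' : ℝ} {g : ℝ → ℂ} (h : VanishesBetween r r' g)
    (m : ℝ → ℂ) : VanishesBetween r r' (transposeDeriv m g) := by
  intro t h1 h2
  have : (fun s => g s * m s) =ᶠ[𝓝 t] fun _ => 0 := by
    filter_upwards [(isOpen_lt continuous_const continuous_abs).mem_nhds h1,
      (isOpen_lt continuous_abs continuous_const).mem_nhds h2] with s hs hs'
    rw [h s hs hs', zero_mul]
  simp [BoundaryDistribution.transposeDeriv, this.deriv_eq]

/-- Because `m c' = 1`, the derivative of `g m (F ∘ c)` is the difference of the two integrands. The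
boundary terms need only `g (± r) = 0`; vanishing on a collar instead of compact support admits
periodic `g` and survives differentiation. -/
theorem integral_mul_comp_eq_transposeDeriv {r₀ r r₁ : ℝ} (h0 : 0 ≤ r₀) (h01 : r₀ < r)
    (h12 : r < r₁) {g m : ℝ → ℂ} (hg : ContDiff ℝ ∞ g) (hm : ContDiff ℝ ∞ m)
    (hg0 : VanishesBetween r₀ r₁ g) {S : Set ℂ} {F f : ℂ → ℂ}
    (hF : ∀ z ∈ S, HasDerivAt F (f z) z) (hf : ContinuousOn f S) {c c' : ℝ → ℂ}
    (hcS : ∀ t ∈ Icc (-r) r, c t ∈ S) (hc : ∀ t ∈ Icc (-r) r, HasDerivAt c (c' t) t)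
    (hc' : ∀ t ∈ Icc (-r) r, m t * c' t = 1) :
    ∫ t in (-r)..r, g t * f (c t) = ∫ t in (-r)..r, transposeDeriv m g t * F (c t) := by
  have hr : -r ≤ r := by linarith
  have hcc : ContinuousOn c (Icc (-r) r) := fun t ht => (hc t ht).continuousAt.continuousWithinAt
  have hFc : ContinuousOn (fun t => F (c t)) (Icc (-r) r) :=
    ContinuousOn.comp (t := S) (fun z hz => (hF z hz).continuousAt.continuousWithinAt) hcc hcS
  have hfc : ContinuousOn (fun t => f (c t)) (Icc (-r) r) := hf.comp hcc hcS
  have hi1 : IntervalIntegrable (fun t => transposeDeriv m g t * F (c t)) volume (-r) r := by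
    refine ContinuousOn.intervalIntegrable ?_
    rw [uIcc_of_le hr]
    exact (contDiff_transposeDeriv hm hg).continuous.continuousOn.mul hFc
  have hi2 : IntervalIntegrable (fun t => g t * f (c t)) volume (-r) r := by
    refine ContinuousOn.intervalIntegrable ?_
    rw [uIcc_of_le hr]
    exact hg.continuous.continuousOn.mul hfc
  have hd : ∀ t ∈ uIcc (-r) r, HasDerivAt (fun t => g t * m t * F (c t))
      (g t * f (c t) - transposeDeriv m g t * F (c t)) t := by
    intro t ht
    rw [uIcc_of_le hr] at ht
    have e1 : HasDerivAt (fun s => g s * m s) (deriv (fun s => g s * m s) t) t :=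
      ((hg.mul hm).differentiable (by simp) t).hasDerivAt
    have e2 := e1.mul ((hF _ (hcS t ht)).comp_of_eq t (hc t ht) rfl)
    refine e2.congr_deriv ?_
    have := hc' t ht
    simp only [transposeDeriv, Function.comp_apply]
    linear_combination (g t * f (c t)) * this
  have h := intervalIntegral.integral_eq_sub_of_hasDerivAt hd (hi2.sub hi1)
  rw [intervalIntegral.integral_sub hi2 hi1, hg0 r (by rwa [abs_of_pos (by linarith)])
    (by rwa [abs_of_pos (by linarith)]), hg0 (-r) (by rwa [abs_neg, abs_of_pos (by linarith)])
    (by rwa [abs_neg, abs_of_pos (by linarith)])] at h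
  simpa [sub_eq_zero] using h

/-- The curves `c y` are contained in a strip for small positive `y` and converge to a curve `c 0`
in the real line; the derivation `m d/dt` is the pull back of `d/dz`. -/
structure IsBoundaryFamily (σ : Side) (δ r y₁ : ℝ) (c m : ℝ → ℝ → ℂ) : Prop where
  pos : 0 < y₁
  contDiff : ContDiff ℝ ∞ (Function.uncurry m)
  continuousOn : ContinuousOn (Function.uncurry c) (Icc 0 y₁ ×ˢ Icc (-r) r)
  mem_closedStrip : ∀ t ∈ Icc (-r) r, c 0 t ∈ closedStrip σ δ
  mem_strip : ∀ y ∈ Ioc 0 y₁, ∀ t ∈ Icc (-r) r, c y t ∈ strip σ δ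
  exists_deriv : ∀ y ∈ Ioc 0 y₁, ∃ c' : ℝ → ℂ, ∀ t ∈ Icc (-r) r,
    HasDerivAt (c y) (c' t) t ∧ m y t * c' t = 1

/-- Projecting both variables onto the rectangle makes the integrand continuous everywhere without
changing it on the rectangle. -/
theorem tendsto_intervalIntegral_of_continuousOn {r y₁ : ℝ} (hr : 0 ≤ r) (hy : 0 < y₁)
    {H : ℝ → ℝ → ℂ} (hH : ContinuousOn (Function.uncurry H) (Icc 0 y₁ ×ˢ Icc (-r) r)) :
    Tendsto (fun y => ∫ t in (-r)..r, H y t) (𝓝[>] 0) (𝓝 (∫ t in (-r)..r, H 0 t)) := by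
  have hr' : -r ≤ r := by linarith
  let G : ℝ → ℝ → ℂ := fun y t => H (projIcc 0 y₁ hy.le y) (projIcc (-r) r hr' t)
  have hG : Continuous (Function.uncurry G) := by
    have e : Continuous fun p : ℝ × ℝ =>
        (((projIcc 0 y₁ hy.le p.1 : ℝ), (projIcc (-r) r hr' p.2 : ℝ)) : ℝ × ℝ) := by fun_prop
    exact hH.comp_continuous e fun p => ⟨Subtype.coe_prop _, Subtype.coe_prop _⟩
  have hc : Continuous fun y => ∫ t in (-r)..r, G y t :=
    intervalIntegral.continuous_parametric_intervalIntegral_of_continuous' hG _ _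
  have heq : ∀ y ∈ Icc 0 y₁, ∫ t in (-r)..r, G y t = ∫ t in (-r)..r, H y t := by
    intro y hy'
    refine intervalIntegral.integral_congr fun t ht => ?_
    rw [uIcc_of_le hr'] at ht
    simp only [G, projIcc_of_mem _ hy', projIcc_of_mem _ ht]
  have h1 := (hc.tendsto 0).mono_left (nhdsWithin_le_nhds (s := Ioi 0))
  rw [heq 0 ⟨le_rfl, hy.le⟩] at h1
  refine h1.congr' ?_
  filter_upwards [Ioo_mem_nhdsGT hy] with y hy'
  exact heq y ⟨hy'.1.le, hy'.2.le⟩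

/-- For `y > 0` three integrations by parts replace `φ` by `Θ`, and the new integrand is continuous
up to `y = 0`. The limit sees only `c 0` and `m 0`, so families with the same boundary data have the
same limit. -/
theorem IsThirdPrimitive.tendsto_integral {σ : Side} {δ : ℝ} {φ Θ : ℂ → ℂ}
    (hΘ : IsThirdPrimitive σ δ φ Θ) {r₀ r r₁ : ℝ} (h0 : 0 ≤ r₀) (h01 : r₀ < r) (h12 : r < r₁)
    {y₁ : ℝ} {c m : ℝ → ℝ → ℂ} (hc : IsBoundaryFamily σ δ r y₁ c m) {g : ℝ → ℂ}
    (hg : ContDiff ℝ ∞ g) (hg0 : VanishesBetween r₀ r₁ g) :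
    Tendsto (fun y => ∫ t in (-r)..r, g t * φ (c y t)) (𝓝[>] 0)
      (𝓝 (∫ t in (-r)..r, transposeDeriv₃ (m 0) g t * Θ (c 0 t))) := by
  obtain ⟨Φ, F, hΦ, hF, hφ⟩ := hΘ.exists_deriv
  have hdiff : ∀ {f F : ℂ → ℂ}, (∀ z ∈ strip σ δ, HasDerivAt F (f z) z) →
      ContinuousOn F (strip σ δ) := fun hF z hz => (hF z hz).continuousAt.continuousWithinAt
  have hsm : ContDiff ℝ ∞ (Function.uncurry fun y => transposeDeriv₃ (m y) g) := by
    have e : ContDiff ℝ ∞ (Function.uncurry fun _ : ℝ => g) := hg.comp contDiff_snd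
    exact contDiff_transposeDeriv_family hc.contDiff (contDiff_transposeDeriv_family hc.contDiff
      (contDiff_transposeDeriv_family hc.contDiff e))
  have hmy : ∀ y, ContDiff ℝ ∞ (m y) := fun y =>
    hc.contDiff.comp (contDiff_const.prodMk contDiff_id)
  have hlim := tendsto_intervalIntegral_of_continuousOn (h0.trans h01.le) hc.pos
    (H := fun y t => transposeDeriv₃ (m y) g t * Θ (c y t)) (by
      refine hsm.continuous.continuousOn.mul (hΘ.continuousOn.comp hc.continuousOn ?_)
      rintro ⟨y, t⟩ ⟨hy, ht⟩
      rcases hy.1.eq_or_lt with h | h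
      · have h : 0 = y := h
        subst h
        exact hc.mem_closedStrip t ht
      · exact strip_subset_closedStrip _ _ (hc.mem_strip y ⟨h, hy.2⟩ t ht))
  refine hlim.congr' ?_
  filter_upwards [Ioo_mem_nhdsGT hc.pos] with y hy
  have hy' : y ∈ Ioc 0 y₁ := ⟨hy.1, hy.2.le⟩
  obtain ⟨c', hc'⟩ := hc.exists_deriv y hy'
  have hS := hc.mem_strip y hy'
  have g1 := contDiff_transposeDeriv (hmy y) hg
  have g2 := contDiff_transposeDeriv (hmy y) g1
  have v1 := hg0.transposeDeriv (m y)
  have v2 := v1.transposeDeriv (m y)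
  rw [integral_mul_comp_eq_transposeDeriv h0 h01 h12 hg (hmy y) hg0 hφ hΘ.holomorphic.continuousOn
      hS (fun t ht => (hc' t ht).1) (fun t ht => (hc' t ht).2),
    integral_mul_comp_eq_transposeDeriv h0 h01 h12 g1 (hmy y) v1 hF (hdiff hφ)
      hS (fun t ht => (hc' t ht).1) (fun t ht => (hc' t ht).2),
    integral_mul_comp_eq_transposeDeriv h0 h01 h12 g2 (hmy y) v2 hΦ (hdiff hF)
      hS (fun t ht => (hc' t ht).1) (fun t ht => (hc' t ht).2)]
  rfl

/-! ### Boundary limits on the line -/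

theorem isBoundaryFamily_line {σ : Side} {δ : ℝ} (hδ : 0 < δ) (r : ℝ) :
    IsBoundaryFamily σ δ r (δ / 2) (fun y t => (t : ℂ) + ((σ.sign * y : ℝ) : ℂ) * Complex.I)
      (fun _ _ => 1) where
  pos := by positivity
  contDiff := contDiff_const
  continuousOn := by
    refine Continuous.continuousOn ?_
    simp only [Function.uncurry_def]
    fun_prop
  mem_closedStrip t _ := by simpa [closedStrip] using hδ
  mem_strip y hy t _ := by
    simp only [strip, mem_ofPred_eq, Complex.add_im, Complex.ofReal_im, Complex.mul_im,
      Complex.ofReal_re, Complex.I_im, Complex.I_re, mul_one, mul_zero, add_zero, zero_add,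
      ← mul_assoc, σ.sign_mul_sign, one_mul]
    exact ⟨hy.1, by linarith [hy.2]⟩
  exists_deriv y _ := ⟨fun _ => 1, fun t _ =>
    ⟨((hasDerivAt_id t).ofReal_comp).add_const _, by simp⟩⟩

theorem integral_eq_intervalIntegral_of_vanishing {h : ℝ → ℂ} {r : ℝ}
    (hh : ∀ t, r ≤ |t| → h t = 0) : ∫ t, h t = ∫ t in (-r)..r, h t := by
  refine (intervalIntegral.integral_eq_integral_of_support_subset fun t ht => ?_).symm
  by_contra hcon
  refine ht (hh t ?_)
  by_contra hlt
  rw [not_le, abs_lt] at hlt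
  exact hcon ⟨hlt.1, hlt.2.le⟩

theorem exists_forall_lt_abs_eq_zero {Ω : Opens ℝ} (f : 𝓓(Ω, ℂ)) :
    ∃ R > 0, ∀ t, R < |t| → f t = 0 := by
  obtain ⟨R, hR⟩ := f.hasCompactSupport.isCompact.isBounded.subset_closedBall 0
  refine ⟨max R 1, by positivity, fun t ht => image_eq_zero_of_notMem_tsupport fun hm => ?_⟩
  have := hR hm
  rw [mem_closedBall_zero_iff, Real.norm_eq_abs] at this
  exact absurd ((le_max_left _ _).trans_lt ht) (not_lt.2 this)

/-- The distribution on the line which is the third derivative of `Θ`. -/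
noncomputable def thirdDerivDistribution (Θ : ℂ → ℂ) : LineDistribution :=
  -(TestFunction.integralAgainstBilinCLM (ContinuousLinearMap.mul ℂ ℂ) volume
      (fun x : ℝ => Θ x)) ∘L
    ((TestFunction.lineDerivCLM ℂ (1 : ℝ) : 𝓓((⊤ : Opens ℝ), ℂ) →L[ℂ] 𝓓((⊤ : Opens ℝ), ℂ)) ∘L
      (TestFunction.lineDerivCLM ℂ (1 : ℝ) : 𝓓((⊤ : Opens ℝ), ℂ) →L[ℂ] 𝓓((⊤ : Opens ℝ), ℂ)) ∘L
      (TestFunction.lineDerivCLM ℂ (1 : ℝ) : 𝓓((⊤ : Opens ℝ), ℂ) →L[ℂ] 𝓓((⊤ : Opens ℝ), ℂ)))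

theorem IsThirdPrimitive.continuous_ofReal {σ : Side} {δ : ℝ} {φ Θ : ℂ → ℂ}
    (hΘ : IsThirdPrimitive σ δ φ Θ) : Continuous fun x : ℝ => Θ x :=
  hΘ.continuousOn.comp_continuous Complex.continuous_ofReal fun x => by
    simpa [closedStrip] using hΘ.pos

theorem thirdDerivDistribution_apply {Θ : ℂ → ℂ} (hΘ : Continuous fun x : ℝ => Θ x)
    (f : 𝓓((⊤ : Opens ℝ), ℂ)) :
    thirdDerivDistribution Θ f = ∫ x : ℝ, transposeDeriv₃ (fun _ => 1) f x * Θ x := by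
  have hli : LocallyIntegrableOn (fun x : ℝ => Θ x) ((⊤ : Opens ℝ) : Set ℝ) volume :=
    hΘ.locallyIntegrable.locallyIntegrableOn _
  have hd : ∀ h : 𝓓((⊤ : Opens ℝ), ℂ),
      ((TestFunction.lineDerivCLM ℂ (1 : ℝ) h : 𝓓((⊤ : Opens ℝ), ℂ)) : ℝ → ℂ) = deriv h := by
    intro h
    funext x
    rw [TestFunction.lineDerivCLM_apply_of_le (by simp)]
    simp [lineDeriv, deriv_comp_const_add]
  -- The sign `(-1) ^ 3` matches the leading minus in `thirdDerivDistribution`.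
  have h3 : transposeDeriv₃ (fun _ => 1) f = fun x => -deriv (deriv (deriv f)) x := by
    have h1 : ∀ h : ℝ → ℂ, transposeDeriv (fun _ => 1) h = fun x => -deriv h x := fun h => by
      funext x
      simp [transposeDeriv]
    funext x
    simp [transposeDeriv₃, h1]
  simp only [thirdDerivDistribution, neg_apply, ContinuousLinearMap.comp_apply]
  rw [TestFunction.integralAgainstBilinCLM_eq_integral hli, h3, hd, hd, hd, ← integral_neg]
  simp

theorem IsThirdPrimitive.isBoundaryLimit {σ : Side} {δ : ℝ} {φ Θ : ℂ → ℂ}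
    (hΘ : IsThirdPrimitive σ δ φ Θ) : IsBoundaryLimit σ φ (thirdDerivDistribution Θ) := by
  intro f
  obtain ⟨R, hR, hf⟩ := exists_forall_lt_abs_eq_zero f
  have hv : ∀ r', VanishesBetween R r' f := fun r' t h _ => hf t h
  have h := hΘ.tendsto_integral hR.le (lt_add_one R) (lt_add_one (R + 1))
    (isBoundaryFamily_line hΘ.pos (R + 1)) f.contDiff (hv _)
  have hvan : ∀ t, R + 1 ≤ |t| → transposeDeriv₃ (fun _ => 1) f t = 0 := fun t ht =>
    (((hv (|t| + 1)).transposeDeriv _).transposeDeriv _).transposeDeriv _ t (by linarith)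
      (lt_add_one _)
  rw [thirdDerivDistribution_apply hΘ.continuous_ofReal,
    integral_eq_intervalIntegral_of_vanishing (r := R + 1)
      fun t ht => by rw [hvan t ht, zero_mul]]
  convert h using 2
  · exact integral_eq_intervalIntegral_of_vanishing
      fun t ht => by rw [hf t (by linarith), zero_mul]
  · simp

/-! ### Boundary limits on the circle, in the half-angle parametrization -/

theorem complex_sin_eq_mk (α β : ℝ) : Complex.sin (α + β * Complex.I) =
    ⟨Real.sin α * Real.cosh β, Real.cos α * Real.sinh β⟩ := by
  rw [Complex.sin_add_mul_I]
  apply Complex.ext <;> simp [Complex.sin_ofReal_re, Complex.cos_ofReal_re, Complex.cosh_ofReal_re,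
    Complex.sinh_ofReal_re]

theorem complex_cos_eq_mk (α β : ℝ) : Complex.cos (α + β * Complex.I) =
    ⟨Real.cos α * Real.cosh β, -(Real.sin α * Real.sinh β)⟩ := by
  rw [Complex.cos_add_mul_I]
  apply Complex.ext <;> simp [Complex.sin_ofReal_re, Complex.cos_ofReal_re, Complex.cosh_ofReal_re,
    Complex.sinh_ofReal_re]

theorem im_tan_add_mul_I (α β : ℝ) :
    (Complex.tan (α + β * Complex.I)).im =
      Real.sinh β * Real.cosh β / (Real.cos α ^ 2 + Real.sinh β ^ 2) := by
  have h1 := Real.sin_sq_add_cos_sq α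
  have h2 := Real.cosh_sq β
  have h3 : (Real.cos α * Real.cosh β) * (Real.cos α * Real.cosh β) +
      -(Real.sin α * Real.sinh β) * -(Real.sin α * Real.sinh β) =
      Real.cos α ^ 2 + Real.sinh β ^ 2 := by
    linear_combination Real.sinh β ^ 2 * h1 + Real.cos α ^ 2 * h2
  rw [Complex.tan, complex_sin_eq_mk, complex_cos_eq_mk, Complex.div_im, Complex.normSq_mk, h3,
    ← sub_div]
  congr 1
  linear_combination Real.sinh β * Real.cosh β * h1

/-- The point `t ± i y` of the complex plane of angles. -/
noncomputable def complexAngle (σ : Side) (y t : ℝ) : ℂ :=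
  (t : ℂ) + ((σ.sign * y : ℝ) : ℂ) * Complex.I

theorem complexAngle_div_two (σ : Side) (y t : ℝ) :
    complexAngle σ y t / 2 = ((t / 2 : ℝ) : ℂ) + ((σ.sign * y / 2 : ℝ) : ℂ) * Complex.I := by
  simp only [complexAngle]
  push_cast
  ring

theorem im_tan_complexAngle (σ : Side) (y t : ℝ) :
    σ.sign * (Complex.tan (complexAngle σ y t / 2)).im =
      Real.sinh (y / 2) * Real.cosh (y / 2) / (Real.cos (t / 2) ^ 2 + Real.sinh (y / 2) ^ 2) := by
  rw [complexAngle_div_two, im_tan_add_mul_I]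
  cases σ
  · simp [Side.sign]
  · simp [Side.sign, neg_div]

theorem cos_complexAngle_ne_zero {σ : Side} {y t : ℝ} (h : Real.cos (t / 2) ≠ 0 ∨ y ≠ 0) :
    Complex.cos (complexAngle σ y t / 2) ≠ 0 := by
  rw [complexAngle_div_two, complex_cos_eq_mk]
  intro h0
  have hre : Real.cos (t / 2) = 0 := by
    simpa [(Real.cosh_pos _).ne'] using congrArg Complex.re h0
  have him := congrArg Complex.im h0
  rcases h with h | h
  · exact h hre
  · have h1 := Real.sin_sq_add_cos_sq (t / 2)
    have h2 : Real.sin (t / 2) ≠ 0 := fun h2 => by simp [hre, h2] at h1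
    simp [h2, h, σ.sign_ne_zero] at him

theorem cos_div_two_pos {r t : ℝ} (hr : r < π) (ht : t ∈ Icc (-r) r) : 0 < Real.cos (t / 2) :=
  Real.cos_pos_of_mem_Ioo ⟨by linarith [ht.1], by linarith [ht.2]⟩

/-- The derivative is written with `1 + cos ζ`, not `cos (ζ / 2)`, so that its reciprocal `m` is
visibly smooth in all `(y, t)`, as `IsBoundaryFamily` requires. -/
theorem hasDerivAt_tan_complexAngle {σ : Side} {y t : ℝ}
    (h : Complex.cos (complexAngle σ y t / 2) ≠ 0) :
    HasDerivAt (fun t : ℝ => Complex.tan (complexAngle σ y t / 2))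
      (1 + Complex.cos (complexAngle σ y t))⁻¹ t := by
  have h1 : HasDerivAt (fun t : ℝ => complexAngle σ y t / 2) (1 / 2) t :=
    (((hasDerivAt_id t).ofReal_comp).add_const _).div_const 2
  refine ((Complex.hasDerivAt_tan h).comp_of_eq t h1 rfl).congr_deriv ?_
  have h2 : complexAngle σ y t = 2 * (complexAngle σ y t / 2) := by ring
  have h3 : 1 + Complex.cos (complexAngle σ y t) = 2 * Complex.cos (complexAngle σ y t / 2) ^ 2 := by
    conv_lhs => rw [h2, Complex.cos_two_mul]
    ring
  rw [h3]
  field_simp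

theorem one_add_cos_ne_zero {ζ : ℂ} (h : Complex.cos (ζ / 2) ≠ 0) : 1 + Complex.cos ζ ≠ 0 := by
  have h2 : ζ = 2 * (ζ / 2) := by ring
  have h3 : 1 + Complex.cos ζ = 2 * Complex.cos (ζ / 2) ^ 2 := by
    conv_lhs => rw [h2, Complex.cos_two_mul]
    ring
  rw [h3]
  simpa using h

theorem contDiff_complexAngle (σ : Side) : ContDiff ℝ ∞ (Function.uncurry (complexAngle σ)) := by
  have h : ContDiff ℝ ∞ (fun x : ℝ => (x : ℂ)) := Complex.ofRealCLM.contDiff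
  exact (h.comp contDiff_snd).add ((h.comp (contDiff_const.mul contDiff_fst)).mul contDiff_const)

theorem contDiff_one_add_cos_complexAngle (σ : Side) :
    ContDiff ℝ ∞ (Function.uncurry fun y t => 1 + Complex.cos (complexAngle σ y t)) := by
  have h : ContDiff ℝ ∞ Complex.cos := Complex.contDiff_cos.restrict_scalars ℝ
  exact contDiff_const.add (h.comp (contDiff_complexAngle σ))

theorem complexAngle_zero (σ : Side) (t : ℝ) : complexAngle σ 0 t = t := by simp [complexAngle]

theorem tan_complexAngle_zero (σ : Side) (t : ℝ) :
    Complex.tan (complexAngle σ 0 t / 2) = ((Real.tan (t / 2) : ℝ) : ℂ) := by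
  rw [complexAngle_zero]
  push_cast
  rfl

theorem exists_isBoundaryFamily_tan {σ : Side} {δ r : ℝ} (hδ : 0 < δ) (hr : 0 ≤ r) (hrπ : r < π) :
    ∃ y₁, IsBoundaryFamily σ δ r y₁ (fun y t => Complex.tan (complexAngle σ y t / 2))
      (fun y t => 1 + Complex.cos (complexAngle σ y t)) := by
  have hcr : 0 < Real.cos (r / 2) := cos_div_two_pos hrπ ⟨by linarith, le_rfl⟩
  -- For `|t| ≤ r < π` the denominator in `im_tan_complexAngle` is at least `cos (r / 2) ^ 2`. Near
  -- `t = π` no such bound holds and the curves leave the strip.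
  obtain ⟨ε, hε, hsmall⟩ : ∃ ε > 0, ∀ y, |y| < ε →
      Real.sinh (y / 2) * Real.cosh (y / 2) < δ * Real.cos (r / 2) ^ 2 := by
    have hcont : ContinuousAt (fun y : ℝ => Real.sinh (y / 2) * Real.cosh (y / 2)) 0 := by
      fun_prop
    have := hcont.eventually_lt (continuousAt_const (y := δ * Real.cos (r / 2) ^ 2))
      (by simp; positivity)
    obtain ⟨ε, hε, h⟩ := Metric.eventually_nhds_iff.1 this
    exact ⟨ε, hε, fun y hy => h (by simpa using hy)⟩
  have hcos : ∀ t ∈ Icc (-r) r, Real.cos (r / 2) ≤ Real.cos (t / 2) := by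
    intro t ht
    rw [← Real.cos_abs (t / 2)]
    refine Real.cos_le_cos_of_nonneg_of_le_pi (abs_nonneg _) (by linarith) ?_
    rw [abs_div, abs_two]
    linarith [abs_le.2 ht]
  have hne : ∀ y, ∀ t ∈ Icc (-r) r, Complex.cos (complexAngle σ y t / 2) ≠ 0 := fun y t ht =>
    cos_complexAngle_ne_zero (Or.inl (cos_div_two_pos hrπ ht).ne')
  refine ⟨ε / 2, by positivity, contDiff_one_add_cos_complexAngle σ, ?_, ?_, ?_, ?_⟩
  · rintro ⟨y, t⟩ ⟨-, ht⟩
    refine ContinuousAt.continuousWithinAt ?_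
    exact ContinuousAt.comp (f := fun p : ℝ × ℝ => complexAngle σ p.1 p.2 / 2)
      (Complex.continuousAt_tan.2 (hne y t ht))
      ((contDiff_complexAngle σ).continuous.div_const 2).continuousAt
  · intro t ht
    simp only [tan_complexAngle_zero, closedStrip, mem_ofPred_eq, Complex.ofReal_im, mul_zero]
    exact ⟨le_rfl, hδ⟩
  · intro y hy t ht
    have hc := cos_div_two_pos hrπ ht
    have hs : 0 < Real.sinh (y / 2) := Real.sinh_pos_iff.2 (by linarith [hy.1])
    have hch := Real.cosh_pos (y / 2)
    simp only [strip, mem_ofPred_eq, im_tan_complexAngle]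
    refine ⟨by positivity, ?_⟩
    rw [div_lt_iff₀ (by positivity)]
    have h1 := hsmall y (by rw [abs_of_pos hy.1]; linarith [hy.2])
    have h2 : δ * Real.cos (r / 2) ^ 2 ≤ δ * (Real.cos (t / 2) ^ 2 + Real.sinh (y / 2) ^ 2) := by
      have := pow_le_pow_left₀ hcr.le (hcos t ht) 2
      gcongr
      nlinarith [sq_nonneg (Real.sinh (y / 2))]
    linarith
  · intro y hy
    exact ⟨_, fun t ht => ⟨hasDerivAt_tan_complexAngle (hne y t ht),
      mul_inv_cancel₀ (one_add_cos_ne_zero (hne y t ht))⟩⟩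

/-! ### Comparison of circles with horizontal lines -/

theorem hasDerivAt_tan_div_two {t : ℝ} (h : Real.cos (t / 2) ≠ 0) :
    HasDerivAt (fun t : ℝ => Real.tan (t / 2)) (1 + Real.cos t)⁻¹ t := by
  have h1 : HasDerivAt (fun t : ℝ => t / 2) (1 / 2) t := (hasDerivAt_id t).div_const 2
  refine ((Real.hasDerivAt_tan h).comp_of_eq t h1 rfl).congr_deriv ?_
  have h3 : 1 + Real.cos t = 2 * Real.cos (t / 2) ^ 2 := by
    rw [Real.cos_sq, show 2 * (t / 2) = t by ring]
    ring
  rw [h3]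
  field_simp

/-- Horizontal lines in the parameter `x = tan (t / 2)`. At `y = 0` the curve and the multiplier are
those of the circle family, which is the reason for this parametrization. -/
theorem isBoundaryFamily_translate_tan {σ : Side} {δ r : ℝ} (hδ : 0 < δ) (hrπ : r < π) :
    IsBoundaryFamily σ δ r (δ / 2)
      (fun y t => ((Real.tan (t / 2) : ℝ) : ℂ) + ((σ.sign * y : ℝ) : ℂ) * Complex.I)
      (fun _ t => 1 + Complex.cos (complexAngle σ 0 t)) where
  pos := by positivity
  contDiff := (contDiff_one_add_cos_complexAngle σ).comp
    (f := fun p : ℝ × ℝ => ((0 : ℝ), p.2)) (contDiff_const.prodMk contDiff_snd)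
  continuousOn := by
    rintro ⟨y, t⟩ ⟨-, ht⟩
    have h1 : ContinuousAt (fun p : ℝ × ℝ => Real.tan (p.2 / 2)) (y, t) :=
      ContinuousAt.comp (f := fun p : ℝ × ℝ => p.2) (g := fun t => Real.tan (t / 2))
        (hasDerivAt_tan_div_two (cos_div_two_pos hrπ ht).ne').continuousAt continuousAt_snd
    refine ContinuousAt.continuousWithinAt ?_
    refine (Complex.continuous_ofReal.continuousAt.comp h1).add ?_
    fun_prop
  mem_closedStrip t _ := by
    simp only [closedStrip, mem_ofPred_eq, mul_zero, Complex.ofReal_zero, zero_mul, add_zero,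
      Complex.ofReal_im]
    exact ⟨le_rfl, hδ⟩
  mem_strip y hy t _ := by
    simp only [strip, mem_ofPred_eq, Complex.add_im, Complex.ofReal_im, Complex.mul_im,
      Complex.ofReal_re, Complex.I_im, Complex.I_re, mul_one, mul_zero, add_zero, zero_add,
      ← mul_assoc, σ.sign_mul_sign, one_mul]
    exact ⟨hy.1, by linarith [hy.2]⟩
  exists_deriv y _ := by
    refine ⟨fun t => (((1 + Real.cos t)⁻¹ : ℝ) : ℂ), fun t ht => ?_⟩
    have hc := (cos_div_two_pos hrπ ht).ne'
    refine ⟨((hasDerivAt_tan_div_two hc).ofReal_comp).add_const _, ?_⟩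
    rw [complexAngle_zero]
    have := one_add_cos_ne_zero (ζ := (t : ℂ)) (by exact_mod_cast hc)
    push_cast
    exact mul_inv_cancel₀ this

/-- The integral of `g` against `φ` over the circle of radius `exp (∓ y)`, in the coordinate
`tan (ζ / 2)` of the extended line. -/
noncomputable def circleMean (σ : Side) (φ : ℂ → ℂ) (y : ℝ) (g : ℝ → ℂ) : ℂ :=
  ∫ t in (-π)..π, g t * φ (Complex.tan (complexAngle σ y t / 2))

theorem integral_eq_of_vanishesBetween {r₀ r : ℝ} (h0 : 0 ≤ r₀) (h01 : r₀ < r) (hrπ : r < π)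
    {g u : ℝ → ℂ} (hg : VanishesBetween r₀ π g) :
    ∫ t in (-π)..π, g t * u t = ∫ t in (-r)..r, g t * u t := by
  -- The endpoint `π` is dropped because `VanishesBetween r₀ π` says nothing at `|t| = π`.
  rw [intervalIntegral.integral_of_le (by linarith [Real.pi_pos]),
    intervalIntegral.integral_of_le (by linarith), integral_Ioc_eq_integral_Ioo]
  refine setIntegral_eq_of_subset_of_forall_sdiff_eq_zero measurableSet_Ioo
    (fun t ht => ⟨by linarith [ht.1], by linarith [ht.2]⟩) ?_
  rintro t ⟨ht, ht'⟩
  rw [hg t ?_ (abs_lt.2 ht), zero_mul]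
  by_contra hlt
  have := abs_lt.1 ((not_lt.1 hlt).trans_lt h01)
  exact ht' ⟨this.1, this.2.le⟩

theorem IsThirdPrimitive.tendsto_circleMean {σ : Side} {δ : ℝ} {φ Θ : ℂ → ℂ}
    (hΘ : IsThirdPrimitive σ δ φ Θ) {r₀ r : ℝ} (h0 : 0 ≤ r₀) (h01 : r₀ < r) (hrπ : r < π)
    {g : ℝ → ℂ} (hg : ContDiff ℝ ∞ g) (hg0 : VanishesBetween r₀ π g) :
    Tendsto (fun y => circleMean σ φ y g) (𝓝[>] 0)
      (𝓝 (∫ t in (-r)..r, transposeDeriv₃ (fun t : ℝ => 1 + Complex.cos t) g t *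
        Θ ((Real.tan (t / 2) : ℝ) : ℂ))) := by
  obtain ⟨y₁, hfam⟩ := exists_isBoundaryFamily_tan (σ := σ) hΘ.pos (h0.trans h01.le) hrπ
  have h := hΘ.tendsto_integral h0 h01 hrπ hfam hg hg0
  simp only [tan_complexAngle_zero] at h
  simp only [complexAngle_zero] at h
  refine h.congr fun y => ?_
  exact (integral_eq_of_vanishesBetween h0 h01 hrπ hg0).symm

theorem IsThirdPrimitive.tendsto_integral_translate_tan {σ : Side} {δ : ℝ} {φ Θ : ℂ → ℂ}
    (hΘ : IsThirdPrimitive σ δ φ Θ) {r₀ r : ℝ} (h0 : 0 ≤ r₀) (h01 : r₀ < r) (hrπ : r < π)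
    {g : ℝ → ℂ} (hg : ContDiff ℝ ∞ g) (hg0 : VanishesBetween r₀ π g) :
    Tendsto (fun y => ∫ t in (-r)..r, g t *
        φ (((Real.tan (t / 2) : ℝ) : ℂ) + ((σ.sign * y : ℝ) : ℂ) * Complex.I)) (𝓝[>] 0)
      (𝓝 (∫ t in (-r)..r, transposeDeriv₃ (fun t : ℝ => 1 + Complex.cos t) g t *
        Θ ((Real.tan (t / 2) : ℝ) : ℂ))) := by
  have h := hΘ.tendsto_integral h0 h01 hrπ (isBoundaryFamily_translate_tan (σ := σ) hΘ.pos hrπ)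
    hg hg0
  simpa only [complexAngle_zero, mul_zero, Complex.ofReal_zero, zero_mul, add_zero] using h

theorem pullback_extendByZero_apply (f : 𝓓((⊤ : Opens ℝ), ℂ)) {t : ℝ} (ht : Real.cos (t / 2) ≠ 0) :
    (pullback (extendByZero f)).1 t = f (Real.tan (t / 2)) := by
  simp only [pullback, extendByZero, tanHalf, if_neg ht]
  rfl

theorem exists_vanishesBetween_pullback_extendByZero (f : 𝓓((⊤ : Opens ℝ), ℂ)) :
    ∃ r₀, 0 ≤ r₀ ∧ r₀ < π ∧ VanishesBetween r₀ π (pullback (extendByZero f)).1 ∧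
      ∀ r, r₀ < r → r < π → ∀ x, Real.tan (r / 2) ≤ |x| → f x = 0 := by
  obtain ⟨R, hR, hf⟩ := exists_forall_lt_abs_eq_zero f
  have hlt := Real.arctan_lt_pi_div_two R
  have hpos := Real.arctan_pos.2 hR
  have htan : ∀ r, 2 * Real.arctan R < r → r < π → R < Real.tan (r / 2) := by
    intro r h1 h2
    have := Real.tan_lt_tan_of_lt_of_lt_pi_div_two (x := Real.arctan R) (y := r / 2)
      (by linarith) (by linarith) (by linarith)
    rwa [Real.tan_arctan] at this
  -- The bound `|x| > R` reads `|t| > 2 arctan R` in the angle.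
  refine ⟨2 * Real.arctan R, by linarith, by linarith, fun t h1 h2 => ?_,
    fun r h1 h2 x hx => hf x ((htan r h1 h2).trans_le hx)⟩
  have hc : 0 < Real.cos (t / 2) := cos_div_two_pos h2 (abs_le.1 le_rfl)
  rw [pullback_extendByZero_apply f hc.ne']
  refine hf _ ((htan _ h1 h2).trans_le ?_)
  rcases abs_cases t with ⟨h, -⟩ | ⟨h, -⟩ <;> rw [h]
  · exact le_abs_self _
  · rw [neg_div, Real.tan_neg]
    exact neg_le_abs _

/-- Substitution `x = tan (t / 2)`: here `dx = dt / (1 + cos t) = (1 + x ^ 2) / 2 dt`, so the weight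
cancels and the factor 2 remains. -/
theorem integral_weighted_eq {σ : Side} {δ : ℝ} {φ : ℂ → ℂ}
    (hφ : ContinuousOn φ (strip σ δ)) (f : 𝓓((⊤ : Opens ℝ), ℂ)) {r y : ℝ} (hr : 0 ≤ r)
    (hrπ : r < π) (hf : ∀ x, Real.tan (r / 2) ≤ |x| → f x = 0) (hy : 0 < y) (hyδ : y < δ) :
    2 * ∫ x : ℝ, weighted f x * φ ((x : ℂ) + ((σ.sign * y : ℝ) : ℂ) * Complex.I) =
      ∫ t in (-r)..r, (pullback (extendByZero f)).1 t *
        φ (((Real.tan (t / 2) : ℝ) : ℂ) + ((σ.sign * y : ℝ) : ℂ) * Complex.I) := by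
  have hcos : ∀ t ∈ uIcc (-r) r, Real.cos (t / 2) ≠ 0 := fun t ht => by
    rw [uIcc_of_le (by linarith)] at ht
    exact (cos_div_two_pos hrπ ht).ne'
  have hcos' : ∀ t ∈ uIcc (-r) r, 1 + Real.cos t ≠ 0 := fun t ht => by
    have := hcos t ht
    rw [← show 2 * (t / 2) = t by ring, Real.cos_two_mul]
    simpa using this
  set u : ℝ → ℂ := fun x => weighted f x * φ ((x : ℂ) + ((σ.sign * y : ℝ) : ℂ) * Complex.I) with hu
  have huc : Continuous u := by
    refine (weighted f).continuous.mul (hφ.comp_continuous (by fun_prop) fun x => ?_)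
    simp only [strip, mem_ofPred_eq, Complex.add_im, Complex.ofReal_im, Complex.mul_im,
      Complex.ofReal_re, Complex.I_im, Complex.I_re, mul_one, mul_zero, add_zero, zero_add,
      ← mul_assoc, σ.sign_mul_sign, one_mul]
    exact ⟨hy, hyδ⟩
  have h1 : ∫ x, u x = ∫ x in (-Real.tan (r / 2))..(Real.tan (r / 2)), u x :=
    integral_eq_intervalIntegral_of_vanishing fun x hx => by
      change f x / _ * _ = 0
      rw [hf x hx, zero_div, zero_mul]
  have h2 := intervalIntegral.integral_deriv_smul_comp (a := -r) (b := r) (g := u)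
    (fun t ht => hasDerivAt_tan_div_two (hcos t ht))
    (ContinuousOn.inv₀ (by fun_prop) hcos') huc
  rw [neg_div, Real.tan_neg] at h2
  rw [h1, ← h2, ← intervalIntegral.integral_const_mul]
  refine intervalIntegral.integral_congr fun t ht => ?_
  have hc := hcos t ht
  have hc' := hcos' t ht
  have h3 : (1 + Real.tan (t / 2) ^ 2) * (1 + Real.cos t) = 2 := by
    rw [← inv_inv (1 + Real.tan (t / 2) ^ 2), Real.inv_one_add_tan_sq hc, Real.cos_sq,
      show 2 * (t / 2) = t by ring]
    field_simp
  have h4 : ((1 + Real.cos t : ℝ) : ℂ)⁻¹ = ((1 + Real.tan (t / 2) ^ 2 : ℝ) : ℂ) / 2 := by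
    rw [inv_eq_iff_eq_inv, inv_div, eq_div_iff (by exact_mod_cast (by positivity))]
    rw [mul_comm]
    exact_mod_cast h3
  have h5 : ((1 + Real.tan (t / 2) ^ 2 : ℝ) : ℂ) ≠ 0 := by exact_mod_cast (by positivity)
  have h6 : weighted f (Real.tan (t / 2)) =
      f (Real.tan (t / 2)) / ((1 + Real.tan (t / 2) ^ 2 : ℝ) : ℂ) := rfl
  simp only [hu, Function.comp_apply, pullback_extendByZero_apply f hc, Complex.real_smul, h6,
    Complex.ofReal_inv, h4]
  field_simp

theorem IsThirdPrimitive.tendsto_circleMean_pullback {σ : Side} {δ : ℝ} {φ Θ : ℂ → ℂ}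
    (hΘ : IsThirdPrimitive σ δ φ Θ) (f : 𝓓((⊤ : Opens ℝ), ℂ)) :
    Tendsto (fun y => circleMean σ φ y (pullback (extendByZero f)).1) (𝓝[>] 0)
      (𝓝 (2 * thirdDerivDistribution Θ (weighted f))) := by
  obtain ⟨r₀, h0, h0π, hv, hf⟩ := exists_vanishesBetween_pullback_extendByZero f
  obtain ⟨r, h01, hrπ⟩ := exists_between h0π
  have h1 := hΘ.tendsto_circleMean h0 h01 hrπ (pullback (extendByZero f)).2.1 hv
  have h2 := hΘ.tendsto_integral_translate_tan h0 h01 hrπ (pullback (extendByZero f)).2.1 hv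
  have h3 := (hΘ.isBoundaryLimit (weighted f)).const_mul 2
  have h4 := h2.congr' (f₂ := fun y => 2 * ∫ x : ℝ, weighted f x *
      φ ((x : ℂ) + ((σ.sign * y : ℝ) : ℂ) * Complex.I)) (by
    filter_upwards [Ioo_mem_nhdsGT hΘ.pos] with y hy
    exact (integral_weighted_eq hΘ.holomorphic.continuousOn f (h0.trans h01.le) hrπ
      (hf r h01 hrπ) hy.1 hy.2).symm)
  rwa [tendsto_nhds_unique h4 h3] at h1

/-! ### The boundary limit on the whole circle -/

/-- Supplies integrability over the whole circle, including near `t = π`, where the curve is outside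
every thin strip. If the curve met `K`, the bound `|z| ≤ R` there would give `cos² + sinh² ≥ 1 / (1
+ R ^ 2)`, hence `|Im z| ≤ (1 + R ^ 2) sinh cosh`, which for small `y` is less than the distance `ε`
of `K` from the real line. -/
theorem HolomorphicNear.eventually_continuous_tan {σ : Side} {φ : ℂ → ℂ}
    (h : HolomorphicNear σ univ φ) :
    ∀ᶠ y in 𝓝[>] (0 : ℝ), Continuous fun t => φ (Complex.tan (complexAngle σ y t / 2)) := by
  obtain ⟨K, hK, h0, hd⟩ := holomorphicNear_univ_iff.1 h
  obtain ⟨R, hR⟩ := hK.isBounded.subset_closedBall 0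
  obtain ⟨ε, hε, hKε⟩ : ∃ ε > 0, ∀ z ∈ K, ε ≤ |z.im| := by
    rcases K.eq_empty_or_nonempty with rfl | hne
    · exact ⟨1, one_pos, by simp⟩
    · obtain ⟨z₀, hz₀, hmin⟩ := hK.exists_isMinOn hne
        (continuous_abs.comp Complex.continuous_im).continuousOn
      exact ⟨|z₀.im|, abs_pos.2 (h0 _ hz₀), fun z hz => hmin hz⟩
  have hcont : ContinuousAt (fun y : ℝ => Real.sinh (y / 2) * Real.cosh (y / 2) * (1 + R ^ 2)) 0 := by
    fun_prop
  have hsmall := hcont.eventually_lt (continuousAt_const (y := ε)) (by simpa using hε)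
  filter_upwards [mem_nhdsWithin_of_mem_nhds hsmall, self_mem_nhdsWithin] with y hy hy0
  have hy0 : 0 < y := hy0
  have hs : 0 < Real.sinh (y / 2) := Real.sinh_pos_iff.2 (by linarith)
  have hch := Real.cosh_pos (y / 2)
  have hpos : ∀ t, 0 < Real.cos (t / 2) ^ 2 + Real.sinh (y / 2) ^ 2 := fun t => by positivity
  have hne : ∀ t, Complex.cos (complexAngle σ y t / 2) ≠ 0 := fun t =>
    cos_complexAngle_ne_zero (Or.inr hy0.ne')
  have hhalf : ∀ t, Complex.tan (complexAngle σ y t / 2) ∈ σ.halfPlane := fun t => by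
    simp only [Side.halfPlane, mem_ofPred_eq, im_tan_complexAngle]
    have := hpos t
    positivity
  have hnotK : ∀ t, Complex.tan (complexAngle σ y t / 2) ∈ Kᶜ := by
    intro t ht
    have h1 := hKε _ ht
    rw [Side.abs_im_of_pos (hhalf t), im_tan_complexAngle, le_div_iff₀ (hpos t)] at h1
    have h2 := hR ht
    rw [mem_closedBall_zero_iff] at h2
    have h3 : Complex.normSq (Complex.tan (complexAngle σ y t / 2)) ≤ R ^ 2 := by
      rw [Complex.normSq_eq_norm_sq]
      exact pow_le_pow_left₀ (norm_nonneg _) h2 2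
    have h4 : Real.sinh (σ.sign * y / 2) ^ 2 = Real.sinh (y / 2) ^ 2 := by
      cases σ <;> simp [Side.sign, neg_div]
    have h5 := Real.sin_sq_add_cos_sq (t / 2)
    have h6 := Real.cosh_sq (σ.sign * y / 2)
    rw [complexAngle_div_two, Complex.tan, map_div₀, complex_sin_eq_mk, complex_cos_eq_mk,
      Complex.normSq_mk, Complex.normSq_mk] at h3
    have e1 : (Real.cos (t / 2) * Real.cosh (σ.sign * y / 2)) *
        (Real.cos (t / 2) * Real.cosh (σ.sign * y / 2)) +
        -(Real.sin (t / 2) * Real.sinh (σ.sign * y / 2)) *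
        -(Real.sin (t / 2) * Real.sinh (σ.sign * y / 2)) =
        Real.cos (t / 2) ^ 2 + Real.sinh (y / 2) ^ 2 := by
      linear_combination Real.sinh (σ.sign * y / 2) ^ 2 * h5 + Real.cos (t / 2) ^ 2 * h6 + h4
    have e2 : (Real.sin (t / 2) * Real.cosh (σ.sign * y / 2)) *
        (Real.sin (t / 2) * Real.cosh (σ.sign * y / 2)) +
        (Real.cos (t / 2) * Real.sinh (σ.sign * y / 2)) *
        (Real.cos (t / 2) * Real.sinh (σ.sign * y / 2)) =
        Real.sin (t / 2) ^ 2 + Real.sinh (y / 2) ^ 2 := by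
      linear_combination Real.sinh (σ.sign * y / 2) ^ 2 * h5 + Real.sin (t / 2) ^ 2 * h6 + h4
    rw [e1, e2, div_le_iff₀ (hpos t)] at h3
    have h7 : 1 ≤ (1 + R ^ 2) * (Real.cos (t / 2) ^ 2 + Real.sinh (y / 2) ^ 2) := by
      nlinarith [sq_nonneg (Real.sinh (y / 2))]
    have h8 : ε * 1 ≤ ε * ((1 + R ^ 2) * (Real.cos (t / 2) ^ 2 + Real.sinh (y / 2) ^ 2)) := by
      gcongr
    have h9 := mul_le_mul_of_nonneg_right h1 (by positivity : 0 ≤ 1 + R ^ 2)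
    linarith
  refine hd.continuousOn.comp_continuous (continuous_iff_continuousAt.2 fun t => ?_)
    fun t => ⟨hnotK t, hhalf t⟩
  exact (hasDerivAt_tan_complexAngle (hne t)).continuousAt

theorem tan_complexAngle_add_pi (σ : Side) (y t : ℝ) :
    Complex.tan (complexAngle σ y (t + π) / 2) = -1 / Complex.tan (complexAngle σ y t / 2) := by
  have h : complexAngle σ y (t + π) / 2 = complexAngle σ y t / 2 + π / 2 := by
    simp only [complexAngle]
    push_cast
    ring
  rw [h, Complex.tan, Complex.tan, Complex.sin_add_pi_div_two, Complex.cos_add_pi_div_two, div_neg,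
    neg_div, one_div_div]

/-- Rotating the circle by `π` inverts `tan (ζ / 2)`, and by periodicity the integral over a full
turn is unchanged. -/
theorem circleMean_eq_inversion {σ : Side} {φ : ℂ → ℂ} {y : ℝ} {g : ℝ → ℂ}
    (hg : Function.Periodic g (2 * π)) :
    circleMean σ φ y g = circleMean σ (inversion φ) y fun t => g (t + π) := by
  have hper : Function.Periodic (fun t => g t * φ (Complex.tan (complexAngle σ y t / 2)))
      (2 * π) := by
    intro t
    have : t + 2 * π = t + π + π := by ring
    simp only [hg t]
    rw [this, tan_complexAngle_add_pi, tan_complexAngle_add_pi, neg_one_div_neg_one_div]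
  have h1 := hper.intervalIntegral_add_eq 0 (-π)
  have h2 := intervalIntegral.integral_comp_add_right (a := -π) (b := π)
    (fun t => g t * φ (Complex.tan (complexAngle σ y t / 2))) π
  rw [show -π + π = 0 by ring, show π + π = 0 + 2 * π by ring, h1,
    show -π + 2 * π = π by ring] at h2
  simp only [circleMean, inversion, ← h2, tan_complexAngle_add_pi]

theorem circleMean_add {σ : Side} {φ : ℂ → ℂ} {y : ℝ}
    (hφ : Continuous fun t => φ (Complex.tan (complexAngle σ y t / 2))) {g h : ℝ → ℂ}
    (hg : Continuous g) (hh : Continuous h) :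
    circleMean σ φ y (fun t => g t + h t) = circleMean σ φ y g + circleMean σ φ y h := by
  simp only [circleMean, add_mul]
  exact intervalIntegral.integral_add ((hg.mul hφ).intervalIntegrable _ _)
    ((hh.mul hφ).intervalIntegrable _ _)

theorem circleMean_const_mul (σ : Side) (φ : ℂ → ℂ) (y : ℝ) (c : ℂ) (g : ℝ → ℂ) :
    circleMean σ φ y (fun t => c * g t) = c * circleMean σ φ y g := by
  simp only [circleMean, mul_assoc]
  exact intervalIntegral.integral_const_mul _ _

/-- A smooth periodic function, equal to `1` near `0` and to `0` near `π`. -/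
noncomputable def angularCutoff (t : ℝ) : ℂ := (Real.smoothTransition (Real.cos t + 1 / 2) : ℝ)

theorem contDiff_angularCutoff : ContDiff ℝ ∞ angularCutoff :=
  Complex.ofRealCLM.contDiff.comp
    (Real.smoothTransition.contDiff.comp (Real.contDiff_cos.add contDiff_const))

theorem periodic_angularCutoff : Function.Periodic angularCutoff (2 * π) := fun t => by
  simp [angularCutoff]

/-- Serves both parts of the partition: `cos t < -1/2` makes the cutoff vanish at `t`, and `cos (t +
π) > 1/2` makes it equal to `1` at `t + π`. -/
theorem cos_lt_of_lt_abs {t : ℝ} (h1 : 2 * π / 3 < |t|) (h2 : |t| < π) : Real.cos t < -(1 / 2) := by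
  have h := Real.cos_lt_cos_of_nonneg_of_le_pi (x := 2 * π / 3) (y := |t|)
    (by positivity) h2.le h1
  rw [Real.cos_abs, show 2 * π / 3 = π - π / 3 by ring, Real.cos_pi_sub, Real.cos_pi_div_three] at h
  exact h

/-- The part of a function on the circle near the angle `0`. -/
noncomputable def nearPart (g : ℝ → ℂ) : ℝ → ℂ := fun t => angularCutoff t * g t

/-- The part of a function on the circle near the angle `π`, shifted to the angle `0`. -/
noncomputable def farPart (g : ℝ → ℂ) : ℝ → ℂ := fun t => (1 - angularCutoff (t + π)) * g (t + π)

theorem contDiff_nearPart {g : ℝ → ℂ} (hg : ContDiff ℝ ∞ g) : ContDiff ℝ ∞ (nearPart g) :=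
  contDiff_angularCutoff.mul hg

theorem contDiff_farPart {g : ℝ → ℂ} (hg : ContDiff ℝ ∞ g) : ContDiff ℝ ∞ (farPart g) := by
  have e : ContDiff ℝ ∞ fun t : ℝ => t + π := by fun_prop
  exact (contDiff_const.sub (contDiff_angularCutoff.comp e)).mul (hg.comp e)

theorem vanishesBetween_nearPart (g : ℝ → ℂ) : VanishesBetween (2 * π / 3) π (nearPart g) := by
  intro t h1 h2
  have := cos_lt_of_lt_abs h1 h2
  rw [nearPart, angularCutoff, Real.smoothTransition.zero_of_nonpos (by linarith)]
  simp

theorem vanishesBetween_farPart (g : ℝ → ℂ) : VanishesBetween (2 * π / 3) π (farPart g) := by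
  intro t h1 h2
  have := cos_lt_of_lt_abs h1 h2
  rw [farPart, angularCutoff, Real.cos_add_pi, Real.smoothTransition.one_of_one_le (by linarith)]
  simp

/-- The boundary value of `φ` in the half-angle parametrization, for functions supported away from
the angle `π`. -/
noncomputable def halfAngleFunctional (Θ : ℂ → ℂ) (g : ℝ → ℂ) : ℂ :=
  ∫ t in (-(5 * π / 6))..(5 * π / 6), transposeDeriv₃ (fun t : ℝ => 1 + Complex.cos t) g t *
    Θ ((Real.tan (t / 2) : ℝ) : ℂ)

/-- The test function is split by `angularCutoff`, and the part near `π` is rotated to `0`, where it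
is tested against the inversion of `φ`. -/
theorem tendsto_circleMean_circle {σ : Side} {δ δ' : ℝ} {φ Θ Θ' : ℂ → ℂ}
    (hφ : HolomorphicNear σ univ φ) (hΘ : IsThirdPrimitive σ δ φ Θ)
    (hΘ' : IsThirdPrimitive σ δ' (inversion φ) Θ') (g : SmoothCircle) :
    Tendsto (fun y => circleMean σ φ y g.1) (𝓝[>] 0)
      (𝓝 (halfAngleFunctional Θ (nearPart g.1) + halfAngleFunctional Θ' (farPart g.1))) := by
  have hπ := Real.pi_pos
  have h1 := hΘ.tendsto_circleMean (by positivity) (by linarith : 2 * π / 3 < 5 * π / 6)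
    (by linarith) (contDiff_nearPart g.2.1) (vanishesBetween_nearPart g.1)
  have h2 := hΘ'.tendsto_circleMean (by positivity) (by linarith : 2 * π / 3 < 5 * π / 6)
    (by linarith) (contDiff_farPart g.2.1) (vanishesBetween_farPart g.1)
  refine (h1.add h2).congr' ?_
  filter_upwards [hφ.eventually_continuous_tan] with y hy
  have hper : Function.Periodic (fun t => (1 - angularCutoff t) * g.1 t) (2 * π) := fun t => by
    simp only [periodic_angularCutoff t, g.2.2 t]
  have hsplit := circleMean_add (h := fun t => (1 - angularCutoff t) * g.1 t) hy
    (contDiff_nearPart g.2.1).continuous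
    ((continuous_const.sub contDiff_angularCutoff.continuous).mul g.2.1.continuous)
  rw [circleMean_eq_inversion hper] at hsplit
  change _ = circleMean σ φ y (nearPart g.1) + circleMean σ (inversion φ) y (farPart g.1) at hsplit
  rw [← hsplit]
  congr 1
  funext t
  simp only [nearPart]
  ring

/-- The point on the circle is `z = exp (2 i ζ)`, and Euler's formulas give `i (1 - z) / (1 + z) =
tan ζ`. The condition `y ≠ 0` keeps `z` away from the pole `-1`. -/
theorem moebiusTransform_circle (σ : Side) (φ : ℂ → ℂ) {y : ℝ} (hy : y ≠ 0) (t : ℝ) :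
    moebiusTransform φ ((Real.exp (-(σ.sign * y)) : ℝ) * Complex.exp (t * Complex.I)) =
      -Complex.I * φ (Complex.tan (complexAngle σ y t / 2)) := by
  set ζ := complexAngle σ y t / 2 with hζ
  have hc : Complex.cos ζ ≠ 0 := cos_complexAngle_ne_zero (Or.inr hy)
  have hz : ((Real.exp (-(σ.sign * y)) : ℝ) : ℂ) * Complex.exp (t * Complex.I) =
      Complex.exp (ζ * Complex.I) * Complex.exp (ζ * Complex.I) := by
    rw [Complex.ofReal_exp, ← Complex.exp_add, ← Complex.exp_add]
    congr 1
    rw [hζ, complexAngle]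
    push_cast
    linear_combination -((σ.sign : ℂ) * y) * Complex.I_sq
  have hinv : Complex.exp (ζ * Complex.I) * Complex.exp (-ζ * Complex.I) = 1 := by
    rw [← Complex.exp_add, neg_mul, add_neg_cancel, Complex.exp_zero]
  have hne := Complex.exp_ne_zero (ζ * Complex.I)
  have hcos : 1 + Complex.exp (ζ * Complex.I) * Complex.exp (ζ * Complex.I) =
      2 * Complex.cos ζ * Complex.exp (ζ * Complex.I) := by
    rw [Complex.cos]
    linear_combination -hinv
  have hsin : Complex.I * (1 - Complex.exp (ζ * Complex.I) * Complex.exp (ζ * Complex.I)) =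
      2 * Complex.sin ζ * Complex.exp (ζ * Complex.I) := by
    rw [Complex.sin]
    linear_combination -Complex.I * hinv
  rw [moebiusTransform, hz, hcos, hsin, Complex.tan]
  congr 2
  field_simp

theorem tendsto_neg_sign_mul_log (σ : Side) :
    Tendsto (fun r : ℝ => -(σ.sign * Real.log r)) σ.radius (𝓝[>] 0) := by
  have hc : Tendsto (fun r : ℝ => -(σ.sign * Real.log r)) (𝓝 1) (𝓝 0) := by
    have : ContinuousAt (fun r : ℝ => -(σ.sign * Real.log r)) 1 :=
      (continuousAt_const.mul (Real.continuousAt_log one_ne_zero)).neg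
    simpa [ContinuousAt] using this
  refine tendsto_nhdsWithin_iff.2 ⟨?_, ?_⟩
  · cases σ <;> exact hc.mono_left nhdsWithin_le_nhds
  · cases σ
    · simp only [Side.radius]
      filter_upwards [Ioo_mem_nhdsLT (zero_lt_one' ℝ)] with r hr
      simpa [Side.sign] using Real.log_neg hr.1 hr.2
    · simp only [Side.radius]
      filter_upwards [self_mem_nhdsWithin] with r hr
      simpa [Side.sign] using Real.log_pos hr

theorem Side.eventually_radius_pos (σ : Side) : ∀ᶠ r in σ.radius, 0 < r := by
  cases σ <;> exact mem_nhdsWithin_of_mem_nhds (lt_mem_nhds one_pos)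

theorem tendsto_moebiusTransform {σ : Side} {φ : ℂ → ℂ} {g : ℝ → ℂ} {L : ℂ}
    (h : Tendsto (fun y => circleMean σ φ y g) (𝓝[>] 0) (𝓝 L)) :
    Tendsto (fun r : ℝ => ∫ t in (-π)..π, g t *
      moebiusTransform φ ((r : ℂ) * Complex.exp (t * Complex.I))) σ.radius
      (𝓝 (-Complex.I * L)) := by
  have h1 := (h.comp (tendsto_neg_sign_mul_log σ)).const_mul (-Complex.I)
  refine h1.congr' ?_
  filter_upwards [σ.eventually_radius_pos,
    (tendsto_neg_sign_mul_log σ).eventually self_mem_nhdsWithin] with r hr hy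
  have hy : 0 < -(σ.sign * Real.log r) := hy
  have hr' : r = Real.exp (-(σ.sign * -(σ.sign * Real.log r))) := by
    rw [mul_neg, ← mul_assoc, σ.sign_mul_sign, one_mul, neg_neg, Real.exp_log hr]
  rw [Function.comp_apply, circleMean, ← intervalIntegral.integral_const_mul]
  refine intervalIntegral.integral_congr fun t _ => ?_
  have := moebiusTransform_circle σ φ hy.ne' t
  rw [← hr'] at this
  simp only [this]
  ring

/-! ### Bounds by finitely many derivatives -/

/-- The derivatives of `g` of order at most `k` are bounded by `M` on `s`. -/
def DerivBound (k : ℕ) (M : ℝ) (s : Set ℝ) (g : ℝ → ℂ) : Prop :=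
  ∀ j ≤ k, ∀ t ∈ s, ‖iteratedDeriv j g t‖ ≤ M

theorem exists_derivBound {k : ℕ} {s : Set ℝ} (hs : IsCompact s) {a : ℝ → ℂ} (ha : ContDiff ℝ ∞ a) :
    ∃ A ≥ 0, DerivBound k A s a := by
  have h : ∀ j, ∃ A, ∀ t ∈ s, ‖iteratedDeriv j a t‖ ≤ A := fun j =>
    hs.exists_bound_of_continuousOn
      (ha.continuous_iteratedDeriv j (by exact_mod_cast le_top)).continuousOn
  choose A hA using h
  refine ⟨∑ j ∈ Finset.range (k + 1), |A j|, Finset.sum_nonneg fun _ _ => abs_nonneg _,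
    fun j hj t ht => ((hA j t ht).trans (le_abs_self _)).trans ?_⟩
  exact Finset.single_le_sum (f := fun j => |A j|) (fun _ _ => abs_nonneg _)
    (Finset.mem_range.2 (Nat.lt_succ_of_le hj))

theorem exists_derivBound_mul (k : ℕ) {s : Set ℝ} (hs : IsCompact s) {a : ℝ → ℂ}
    (ha : ContDiff ℝ ∞ a) : ∃ C ≥ 0, ∀ (g : ℝ → ℂ) (M : ℝ), ContDiff ℝ ∞ g → DerivBound k M s g →
      DerivBound k (C * M) s fun t => a t * g t := by
  obtain ⟨A, hA0, hA⟩ := exists_derivBound (k := k) hs ha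
  -- Leibniz rule: the binomial coefficients of order `j ≤ k` sum to `2 ^ j ≤ 2 ^ k`.
  refine ⟨2 ^ k * A, by positivity, fun g M hg hb j hj t ht => ?_⟩
  have hM : 0 ≤ M := (norm_nonneg _).trans (hb j hj t ht)
  have h := norm_iteratedFDeriv_mul_le (n := j) (N := ∞) ha hg t (by exact_mod_cast le_top)
  simp only [norm_iteratedFDeriv_eq_norm_iteratedDeriv] at h
  refine h.trans ?_
  calc ∑ i ∈ Finset.range (j + 1), (j.choose i : ℝ) * ‖iteratedDeriv i a t‖ *
        ‖iteratedDeriv (j - i) g t‖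
      ≤ ∑ i ∈ Finset.range (j + 1), (j.choose i : ℝ) * A * M := by
        refine Finset.sum_le_sum fun i hi => ?_
        have hi' : i ≤ j := Nat.lt_succ_iff.1 (Finset.mem_range.1 hi)
        gcongr
        · exact hA i (hi'.trans hj) t ht
        · exact hb (j - i) ((Nat.sub_le _ _).trans hj) t ht
    _ = 2 ^ j * (A * M) := by
        have hsum : (2 : ℝ) ^ j = ∑ i ∈ Finset.range (j + 1), (j.choose i : ℝ) := by
          exact_mod_cast (Nat.sum_range_choose j).symm
        rw [hsum, Finset.sum_mul]
        exact Finset.sum_congr rfl fun _ _ => by ring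
    _ ≤ 2 ^ k * (A * M) := by
        gcongr
        norm_num
    _ = 2 ^ k * A * M := by ring

theorem exists_derivBound_transposeDeriv (k : ℕ) {s : Set ℝ} (hs : IsCompact s) {m : ℝ → ℂ}
    (hm : ContDiff ℝ ∞ m) : ∃ C ≥ 0, ∀ (g : ℝ → ℂ) (M : ℝ), ContDiff ℝ ∞ g →
      DerivBound (k + 1) M s g → DerivBound k (C * M) s (transposeDeriv m g) := by
  obtain ⟨C, hC, h⟩ := exists_derivBound_mul (k + 1) hs hm
  refine ⟨C, hC, fun g M hg hb j hj t ht => ?_⟩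
  have h1 := h g M hg hb (j + 1) (by omega) t ht
  have h2 : transposeDeriv m g = fun t => -deriv (fun s => m s * g s) t := by
    have : (fun s => m s * g s) = fun s => g s * m s := funext fun _ => mul_comm _ _
    rw [this]
    rfl
  rwa [h2, iteratedDeriv_fun_neg, norm_neg, ← iteratedDeriv_succ']

/-- Each of the three transposed derivations costs one derivative of `g`, and `Θ (tan (t / 2))` is
bounded since the interval of integration stays away from `± π`. -/
theorem exists_norm_halfAngleFunctional_le {Θ : ℂ → ℂ} (hΘ : Continuous fun x : ℝ => Θ x) :
    ∃ C ≥ 0, ∀ (g : ℝ → ℂ) (M : ℝ), ContDiff ℝ ∞ g → DerivBound 3 M (Icc (-π) π) g →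
      ‖halfAngleFunctional Θ g‖ ≤ C * M := by
  have hπ := Real.pi_pos
  have hm : ContDiff ℝ ∞ fun t : ℝ => 1 + Complex.cos t :=
    contDiff_const.add ((Complex.contDiff_cos.restrict_scalars ℝ).comp Complex.ofRealCLM.contDiff)
  obtain ⟨C₁, hC₁, h₁⟩ := exists_derivBound_transposeDeriv 2 (isCompact_Icc (a := -π) (b := π)) hm
  obtain ⟨C₂, hC₂, h₂⟩ := exists_derivBound_transposeDeriv 1 (isCompact_Icc (a := -π) (b := π)) hm
  obtain ⟨C₃, hC₃, h₃⟩ := exists_derivBound_transposeDeriv 0 (isCompact_Icc (a := -π) (b := π)) hm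
  obtain ⟨A, hA⟩ : ∃ A, ∀ t ∈ Icc (-(5 * π / 6)) (5 * π / 6),
      ‖Θ ((Real.tan (t / 2) : ℝ) : ℂ)‖ ≤ A := by
    refine isCompact_Icc.exists_bound_of_continuousOn fun t ht =>
      ContinuousAt.continuousWithinAt ?_
    exact hΘ.continuousAt.comp (f := fun t : ℝ => Real.tan (t / 2))
      (hasDerivAt_tan_div_two (cos_div_two_pos (by linarith) ht).ne').continuousAt
  refine ⟨C₃ * C₂ * C₁ * |A| * (5 * π / 3), by positivity, fun g M hg hb => ?_⟩
  have b1 := h₁ g M hg hb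
  have b2 := h₂ _ _ (contDiff_transposeDeriv hm hg) b1
  have b3 := h₃ _ _ (contDiff_transposeDeriv hm (contDiff_transposeDeriv hm hg)) b2
  refine (intervalIntegral.norm_integral_le_of_norm_le_const
    (C := C₃ * (C₂ * (C₁ * M)) * |A|) fun t ht => ?_).trans (le_of_eq ?_)
  · rw [uIoc_of_le (by linarith)] at ht
    have e1 := b3 0 le_rfl t ⟨by linarith [ht.1], by linarith [ht.2]⟩
    rw [iteratedDeriv_zero] at e1
    rw [norm_mul]
    have e2 := (hA t ⟨ht.1.le, ht.2⟩).trans (le_abs_self A)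
    exact mul_le_mul e1 e2 (norm_nonneg _) ((norm_nonneg _).trans e1)
  · rw [show 5 * π / 6 - -(5 * π / 6) = 5 * π / 3 by ring,
      abs_of_pos (by positivity : 0 < 5 * π / 3)]
    ring

theorem periodic_iteratedDeriv {g : ℝ → ℂ} {T : ℝ} (hg : Function.Periodic g T) (j : ℕ) :
    Function.Periodic (iteratedDeriv j g) T := by
  intro t
  have h := congrFun (iteratedDeriv_comp_add_const (n := j) (f := g) (s := T)) t
  rw [← h]
  congr 1
  exact funext hg

/-- Needed because the shift by `π` in `farPart` leaves the interval `[-π, π]`. -/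
theorem DerivBound.univ_of_periodic {k : ℕ} {M : ℝ} {g : ℝ → ℂ} (hg : Function.Periodic g (2 * π))
    (h : DerivBound k M (Icc (-π) π) g) : DerivBound k M univ g := by
  intro j hj t _
  obtain ⟨u, hu, htu⟩ := (periodic_iteratedDeriv hg j).exists_mem_Ico (by positivity) t (-π)
  rw [htu]
  exact h j hj u ⟨hu.1, by linarith [hu.2]⟩

theorem DerivBound.comp_add_const {k : ℕ} {M : ℝ} {g : ℝ → ℂ} (h : DerivBound k M univ g) (a : ℝ) :
    DerivBound k M univ fun t => g (t + a) := by
  intro j hj t _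
  rw [iteratedDeriv_comp_add_const]
  exact h j hj _ trivial

/-- Linearity is inherited from the means by uniqueness of limits; the derivative bound comes from
the explicit formula for the limit in terms of `Θ` and `Θ'`. -/
theorem exists_circle_functional {σ : Side} {φ : ℂ → ℂ} (hφ : BehavesSimplyOn σ univ φ) :
    ∃ B : SmoothCircle →ₗ[ℂ] ℂ, IsCircleBoundaryLimit σ (moebiusTransform φ) B ∧
      ∀ g : SmoothCircle, Tendsto (fun y => circleMean σ φ y g.1) (𝓝[>] 0)
        (𝓝 (Complex.I * B g)) := by
  obtain ⟨δ, Θ, hΘ⟩ := hφ.exists_isThirdPrimitive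
  obtain ⟨δ', Θ', hΘ'⟩ := hφ.inversion.exists_isThirdPrimitive
  set Λ : SmoothCircle → ℂ := fun g =>
    halfAngleFunctional Θ (nearPart g.1) + halfAngleFunctional Θ' (farPart g.1) with hΛdef
  have hΛ : ∀ g : SmoothCircle, Tendsto (fun y => circleMean σ φ y g.1) (𝓝[>] 0) (𝓝 (Λ g)) :=
    tendsto_circleMean_circle hφ.1 hΘ hΘ'
  have hadd : ∀ g h, Λ (g + h) = Λ g + Λ h := by
    intro g h
    refine tendsto_nhds_unique (hΛ (g + h)) (((hΛ g).add (hΛ h)).congr' ?_)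
    filter_upwards [hφ.1.eventually_continuous_tan] with y hy
    exact (circleMean_add hy g.2.1.continuous h.2.1.continuous).symm
  have hsmul : ∀ (c : ℂ) g, Λ (c • g) = c * Λ g := by
    intro c g
    refine tendsto_nhds_unique (hΛ (c • g)) (((hΛ g).const_mul c).congr fun y => ?_)
    exact (circleMean_const_mul σ φ y c g.1).symm
  let B : SmoothCircle →ₗ[ℂ] ℂ :=
    { toFun := fun g => -Complex.I * Λ g
      map_add' := fun g h => by rw [hadd, mul_add]
      map_smul' := fun c g => by
        rw [hsmul, RingHom.id_apply, smul_eq_mul]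
        ring }
  have hB : ∀ g, B g = -Complex.I * Λ g := fun _ => rfl
  refine ⟨B, ⟨?_, fun g => ?_⟩, fun g => ?_⟩
  · obtain ⟨C₁, hC₁, h₁⟩ := exists_norm_halfAngleFunctional_le hΘ.continuous_ofReal
    obtain ⟨C₂, hC₂, h₂⟩ := exists_norm_halfAngleFunctional_le hΘ'.continuous_ofReal
    have hcut : ContDiff ℝ ∞ fun t => 1 - angularCutoff (t + π) :=
      contDiff_const.sub (contDiff_angularCutoff.comp (by fun_prop))
    obtain ⟨C₃, hC₃, h₃⟩ := exists_derivBound_mul 3 (isCompact_Icc (a := -π) (b := π))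
      contDiff_angularCutoff
    obtain ⟨C₄, hC₄, h₄⟩ := exists_derivBound_mul 3 (isCompact_Icc (a := -π) (b := π)) hcut
    refine ⟨3, C₁ * C₃ + C₂ * C₄, fun g M hb => ?_⟩
    have hshift : ContDiff ℝ ∞ fun t => g.1 (t + π) := g.2.1.comp (by fun_prop)
    have hbu := (DerivBound.univ_of_periodic g.2.2 hb).comp_add_const π
    have e1 := h₁ _ _ (contDiff_nearPart g.2.1) (h₃ g.1 M g.2.1 hb)
    have e2 := h₂ _ _ (contDiff_farPart g.2.1)
      (h₄ (fun t => g.1 (t + π)) M hshift fun j hj t _ => hbu j hj t trivial)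
    rw [hB, norm_mul, norm_neg, Complex.norm_I, one_mul]
    refine (norm_add_le _ _).trans ((add_le_add e1 e2).trans (le_of_eq ?_))
    ring
  · rw [hB]
    exact tendsto_moebiusTransform (hΛ g)
  · rw [hB, ← mul_assoc, mul_neg, Complex.I_mul_I, neg_neg, one_mul]
    exact hΛ g

/-! ### Distributions on the extended line -/

theorem pullback_add_pi (f : SmoothExt) (t : ℝ) :
    (pullback f).1 (t + π) = (pullback (SmoothExt.inverted f)).1 t := by
  change f.1 (tanHalf (t + π)) = f.1 (negInv (tanHalf t))
  rw [← negInv_tanHalf_add_pi t, negInv_negInv]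

theorem pullback_inverted_add_pi (f : SmoothExt) (t : ℝ) :
    (pullback (SmoothExt.inverted f)).1 (t + π) = (pullback f).1 t := by
  change f.1 (negInv (tanHalf (t + π))) = f.1 (tanHalf t)
  rw [negInv_tanHalf_add_pi]

theorem tan_div_two_mem_Icc {t : ℝ} (ht : t ∈ Icc (-(π / 2)) (π / 2)) :
    Real.tan (t / 2) ∈ Icc (-1 : ℝ) 1 := by
  have hπ := Real.pi_pos
  have hmono := Real.strictMonoOn_tan.monotoneOn
  have h1 := hmono (a := t / 2) (b := π / 4) ⟨by linarith [ht.1], by linarith [ht.2]⟩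
    ⟨by linarith, by linarith⟩ (by linarith [ht.2])
  have h2 := hmono (a := -(π / 4)) (b := t / 2) ⟨by linarith, by linarith⟩
    ⟨by linarith [ht.1], by linarith [ht.2]⟩ (by linarith [ht.1])
  rw [Real.tan_neg, Real.tan_pi_div_four] at h2
  rw [Real.tan_pi_div_four] at h1
  exact ⟨h2, h1⟩

theorem exists_derivBound_pullback (k : ℕ) : ∃ C ≥ 0, ∀ (f : SmoothExt) (M : ℝ),
    DerivBound k M (Icc (-1) 1) (fun x : ℝ => f.1 x) →
      DerivBound k (C * M) (Icc (-(π / 2)) (π / 2)) (pullback f).1 := by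
  have hπ := Real.pi_pos
  have hsub : Icc (-(π / 2)) (π / 2) ⊆ Ioo (-π) π := fun t ht =>
    ⟨by linarith [ht.1], by linarith [ht.2]⟩
  have hcos : ∀ t ∈ Ioo (-π) π, Real.cos (t / 2) ≠ 0 := fun t ht =>
    (Real.cos_pos_of_mem_Ioo ⟨by linarith [ht.1], by linarith [ht.2]⟩).ne'
  have htan : ContDiffOn ℝ ∞ (fun t : ℝ => Real.tan (t / 2)) (Ioo (-π) π) := fun t ht =>
    ((Real.contDiffAt_tan.2 (hcos t ht)).comp t (f := fun t : ℝ => t / 2)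
      (contDiffAt_id.div_const 2)).contDiffWithinAt
  have hu : UniqueDiffOn ℝ (Ioo (-π) π) := isOpen_Ioo.uniqueDiffOn
  have hbd : ∀ i : ℕ, ∃ A, ∀ t ∈ Icc (-(π / 2)) (π / 2),
      ‖iteratedFDerivWithin ℝ i (fun t : ℝ => Real.tan (t / 2)) (Ioo (-π) π) t‖ ≤ A := fun i =>
    isCompact_Icc.exists_bound_of_continuousOn
      ((htan.continuousOn_iteratedFDerivWithin (by exact_mod_cast le_top) hu).mono hsub)
  choose A hA using hbd
  -- The bound for a composition asks that the `i`-th inner derivative be at most `D ^ i`; the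
  -- summand `1` ensures `D ≤ D ^ i` for `i ≥ 1`.
  set D : ℝ := 1 + ∑ i ∈ Finset.range (k + 1), |A i| with hD
  have hD1 : 1 ≤ D := by
    have : 0 ≤ ∑ i ∈ Finset.range (k + 1), |A i| := Finset.sum_nonneg fun _ _ => abs_nonneg _
    linarith
  refine ⟨k.factorial * D ^ k, by positivity, fun f M hb j hj t ht => ?_⟩
  have hM : 0 ≤ M := (norm_nonneg _).trans (hb 0 (Nat.zero_le _) 0 ⟨by norm_num, by norm_num⟩)
  have heq : EqOn (pullback f).1 ((fun x : ℝ => f.1 x) ∘ fun t : ℝ => Real.tan (t / 2))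
      (Ioo (-π) π) := fun u hu' => by
    change f.1 (tanHalf u) = _
    simp [tanHalf, hcos u hu']
  rw [← norm_iteratedFDeriv_eq_norm_iteratedDeriv,
    ← iteratedFDerivWithin_of_isOpen j isOpen_Ioo (hsub ht),
    iteratedFDerivWithin_congr heq (hsub ht)]
  have h := norm_iteratedFDerivWithin_comp_le (n := j) (N := ∞) (t := univ) (C := M) (D := D)
    (contDiffOn_univ.2 f.2.1) htan (by exact_mod_cast le_top) uniqueDiffOn_univ hu
    (mapsTo_univ _ _) (hsub ht)
    (fun i hi => by
      rw [iteratedFDerivWithin_univ, norm_iteratedFDeriv_eq_norm_iteratedDeriv]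
      exact hb i (hi.trans hj) _ (tan_div_two_mem_Icc ht))
    (fun i hi1 hi => by
      have e1 : |A i| ≤ ∑ i ∈ Finset.range (k + 1), |A i| :=
        Finset.single_le_sum (f := fun i => |A i|) (fun _ _ => abs_nonneg _)
          (Finset.mem_range.2 (Nat.lt_succ_of_le (hi.trans hj)))
      have e2 : D ≤ D ^ i := le_self_pow₀ hD1 (by omega)
      linarith [hA i t ht, le_abs_self (A i)])
  refine h.trans ?_
  calc (j.factorial : ℝ) * M * D ^ j ≤ k.factorial * M * D ^ k := by
        gcongr
    _ = k.factorial * D ^ k * M := by ring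

/-- The arc `|t| ≤ π / 2` is the part `[-1, 1]` of the chart `x`. The two remaining arcs, rotated by
`π`, fall into the part `[-1, 1]` of the chart `-1 / x`. -/
theorem isExtDistribution_of_pullback {B : SmoothCircle →ₗ[ℂ] ℂ} (hB : IsCircleDistribution B)
    {J : SmoothExt →ₗ[ℂ] ℂ} {c : ℂ} (hJ : ∀ f, J f = c * B (pullback f)) : IsExtDistribution J := by
  have hπ := Real.pi_pos
  obtain ⟨k, C, hC⟩ := hB
  obtain ⟨A, hA0, hA⟩ := exists_derivBound_pullback k
  refine ⟨k, ‖c‖ * (C * A), fun f M hb => ?_⟩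
  have h1 := hA f M fun j hj x hx => (hb j hj x hx).1
  have h2 := hA (SmoothExt.inverted f) M fun j hj x hx => (hb j hj x hx).2
  have hshift : ∀ j t, iteratedDeriv j (pullback f).1 (t + π) =
      iteratedDeriv j (pullback (SmoothExt.inverted f)).1 t := by
    intro j t
    have h := congrFun (iteratedDeriv_comp_add_const (n := j) (f := (pullback f).1) (s := π)) t
    rw [← h]
    congr 1
    exact funext (pullback_add_pi f)
  have h3 := hC (pullback f) (A * M) fun j hj t ht => by
    rcases le_or_gt t (-(π / 2)) with h | h
    · rw [← periodic_iteratedDeriv (pullback f).2.2 j t, show t + 2 * π = t + π + π by ring, hshift]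
      exact h2 j hj _ ⟨by linarith [ht.1], by linarith⟩
    · rcases le_or_gt t (π / 2) with h' | h'
      · exact h1 j hj t ⟨h.le, h'⟩
      · rw [show t = t - π + π by ring, hshift]
        exact h2 j hj _ ⟨by linarith, by linarith [ht.2]⟩
  rw [hJ, norm_mul, mul_assoc, mul_assoc]
  exact mul_le_mul_of_nonneg_left h3 (norm_nonneg _)

/-! ### Gluing -/

theorem inverted_extendByZero_toLine_inverted (f : 𝓓(puncturedLine, ℂ)) :
    SmoothExt.inverted (extendByZero (toLine (inverted f))) = extendByZero (toLine f) := by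
  have hzero : f 0 = 0 := image_eq_zero_of_notMem_tsupport fun h => f.tsupport_subset h rfl
  refine Subtype.ext (funext fun y => ?_)
  induction y using OnePoint.rec with
  | infty =>
    -- Division by zero gives `-1 / 0 = 0`, so this is `f 0 = 0`.
    change f (-1 / 0) = 0
    simpa using hzero
  | coe x =>
    change (extendByZero (toLine (inverted f))).1 (negInv (x : OnePoint ℝ)) = f x
    rcases eq_or_ne x 0 with rfl | hx
    · rw [hzero, show negInv ((0 : ℝ) : OnePoint ℝ) = OnePoint.infty by simp [negInv]]
      rfl
    · rw [show negInv (x : OnePoint ℝ) = ((-1 / x : ℝ) : OnePoint ℝ) by simp [negInv, hx]]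
      change f (-1 / (-1 / x)) = f x
      congr 1
      field_simp

/-- Every smooth function on the extended line is the sum of functions supported in the two
charts. -/
theorem SmoothExt.exists_eq_add (f : SmoothExt) : ∃ f₁ f₂ : 𝓓((⊤ : Opens ℝ), ℂ),
    f = extendByZero f₁ + SmoothExt.inverted (extendByZero f₂) := by
  let b : ContDiffBump (0 : ℝ) := ⟨1, 2, one_pos, one_lt_two⟩
  have hb : ContDiff ℝ ∞ fun x : ℝ => ((b x : ℝ) : ℂ) := Complex.ofRealCLM.contDiff.comp b.contDiff
  have hbs : HasCompactSupport fun x : ℝ => ((b x : ℝ) : ℂ) :=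
    b.hasCompactSupport.comp_left Complex.ofReal_zero
  let χ : 𝓓((⊤ : Opens ℝ), ℂ) := ⟨fun x => ((b x : ℝ) : ℂ), hb, hbs, by simp⟩
  have hχ : ∀ x : ℝ, |x| ≤ 1 → χ x = 1 := fun x hx => by
    have : b x = 1 := b.one_of_mem_closedBall (by simpa [b] using hx)
    change ((b x : ℝ) : ℂ) = 1
    rw [this, Complex.ofReal_one]
  let f₁ : 𝓓((⊤ : Opens ℝ), ℂ) :=
    ⟨fun x => χ x * f.1 x, χ.contDiff.mul f.2.1, χ.hasCompactSupport.mul_right, by simp⟩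
  let f₂ : 𝓓((⊤ : Opens ℝ), ℂ) :=
    ⟨fun x => (1 - (extendByZero χ).1 (negInv x)) * f.1 (negInv x),
      (contDiff_const.sub (extendByZero χ).2.2).mul f.2.2,
      -- For `|x| > 1` the point `-1 / x` lies in `[-1, 1]`, where `χ = 1`.
      HasCompactSupport.intro (isCompact_closedBall 0 1) fun x hx => by
        rw [mem_closedBall_zero_iff, not_le, Real.norm_eq_abs] at hx
        have hx0 : x ≠ 0 := fun h => by
          rw [h, abs_zero] at hx
          linarith
        have h1 : negInv (x : OnePoint ℝ) = ((-1 / x : ℝ) : OnePoint ℝ) := by simp [negInv, hx0]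
        have h2 : (extendByZero χ).1 ((-1 / x : ℝ) : OnePoint ℝ) = 1 := by
          refine hχ _ ?_
          rw [abs_div, abs_neg, abs_one]
          exact (div_le_one (by linarith)).2 hx.le
        rw [h1, h2, sub_self, zero_mul],
      by simp⟩
  refine ⟨f₁, f₂, Subtype.ext (funext fun y => ?_)⟩
  change f.1 y = (extendByZero f₁).1 y + (extendByZero f₂).1 (negInv y)
  induction y using OnePoint.rec with
  | infty =>
    change f.1 OnePoint.infty = 0 + (1 - (extendByZero χ).1 (negInv ((0 : ℝ) : OnePoint ℝ))) *
      f.1 (negInv ((0 : ℝ) : OnePoint ℝ))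
    rw [show negInv ((0 : ℝ) : OnePoint ℝ) = OnePoint.infty by simp [negInv]]
    change _ = 0 + (1 - 0) * _
    ring
  | coe x =>
    rcases eq_or_ne x 0 with rfl | hx
    · rw [show negInv ((0 : ℝ) : OnePoint ℝ) = OnePoint.infty by simp [negInv]]
      change _ = χ 0 * f.1 ((0 : ℝ) : OnePoint ℝ) + 0
      rw [hχ 0 (by simp)]
      ring
    · have h1 : negInv (x : OnePoint ℝ) = ((-1 / x : ℝ) : OnePoint ℝ) := by simp [negInv, hx]
      have h2 := negInv_negInv (x : OnePoint ℝ)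
      rw [h1] at h2 ⊢
      change _ = χ x * f.1 x + (1 - (extendByZero χ).1 (negInv ((-1 / x : ℝ) : OnePoint ℝ))) *
        f.1 (negInv ((-1 / x : ℝ) : OnePoint ℝ))
      rw [h2]
      change _ = χ x * f.1 x + (1 - χ x) * f.1 x
      ring

theorem IsGluing.unique {T T' : LineDistribution} {J J' : SmoothExt →ₗ[ℂ] ℂ} (hJ : IsGluing T T' J)
    (hJ' : IsGluing T T' J') : J' = J := by
  refine LinearMap.ext fun f => ?_
  obtain ⟨f₁, f₂, rfl⟩ := SmoothExt.exists_eq_add f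
  rw [map_add, map_add, hJ.2.1, hJ.2.2, hJ'.2.1, hJ'.2.2]

/-- A test function supported off `0` and `∞` can be read in either chart, and both readings are the
same value of `J`. -/
theorem IsGluing.apply_eq_apply_inverted {T T' : LineDistribution} {J : SmoothExt →ₗ[ℂ] ℂ}
    (hJ : IsGluing T T' J) (f : 𝓓(puncturedLine, ℂ)) :
    T (weighted (toLine f)) = T' (weighted (toLine (inverted f))) := by
  rw [← hJ.2.1, ← hJ.2.2, inverted_extendByZero_toLine_inverted]

/-- The pull back of functions on the extended line to the circle, as a linear map. -/
noncomputable def pullbackLinear : SmoothExt →ₗ[ℂ] SmoothCircle where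
  toFun := pullback
  map_add' _ _ := rfl
  map_smul' _ _ := rfl

end BoundaryDistribution

theorem mainTheorem2 (σ : Side) (φ : ℂ → ℂ) (hφ : BehavesSimplyOn σ univ φ) :
    BehavesSimplyOn σ univ (inversion φ) ∧
    ∃ T T' : LineDistribution,
      IsBoundaryLimit σ φ T ∧ IsBoundaryLimit σ (inversion φ) T' ∧
      (∀ f : 𝓓(puncturedLine, ℂ), T (weighted (toLine f)) = T' (weighted (toLine (inverted f)))) ∧
      ∃ J : SmoothExt →ₗ[ℂ] ℂ, IsGluing T T' J ∧ (∀ J', IsGluing T T' J' → J' = J) ∧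
        ∃ B : SmoothCircle →ₗ[ℂ] ℂ, IsCircleBoundaryLimit σ (moebiusTransform φ) B ∧
          ∀ f : SmoothExt, B (pullback f) = -Complex.I * (2 * J f) := by
  obtain ⟨δ, Θ, hΘ⟩ := hφ.exists_isThirdPrimitive
  obtain ⟨δ', Θ', hΘ'⟩ := hφ.inversion.exists_isThirdPrimitive
  obtain ⟨B, hB, hlim⟩ := exists_circle_functional hφ
  -- The factor `i / 2` inverts the factor `-2 i` of the final formula. It remains to check that
  -- this pull back of `B` restricts correctly to the two charts.
  let J : SmoothExt →ₗ[ℂ] ℂ := (Complex.I / 2) • (B ∘ₗ pullbackLinear)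
  have hJ : ∀ f, J f = Complex.I / 2 * B (pullback f) := fun _ => rfl
  have hglue : IsGluing (thirdDerivDistribution Θ) (thirdDerivDistribution Θ') J := by
    refine ⟨isExtDistribution_of_pullback hB.1 hJ, fun f => ?_, fun f => ?_⟩
    · have h := tendsto_nhds_unique (hlim (pullback (extendByZero f)))
        (hΘ.tendsto_circleMean_pullback f)
      rw [hJ]
      linear_combination h / 2
    · have h1 := hlim (pullback (SmoothExt.inverted (extendByZero f)))
      -- Rotation by `π` reduces the chart at `∞` to the finite chart, with `φ` replaced by its
      -- inversion.
      have h2 : ∀ y, circleMean σ φ y (pullback (SmoothExt.inverted (extendByZero f))).1 =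
          circleMean σ (inversion φ) y (pullback (extendByZero f)).1 := fun y => by
        rw [circleMean_eq_inversion (pullback (SmoothExt.inverted (extendByZero f))).2.2]
        simp only [pullback_inverted_add_pi]
      simp only [h2] at h1
      have h := tendsto_nhds_unique h1 (hΘ'.tendsto_circleMean_pullback f)
      rw [hJ]
      linear_combination h / 2
  refine ⟨hφ.inversion, thirdDerivDistribution Θ, thirdDerivDistribution Θ', hΘ.isBoundaryLimit,
    hΘ'.isBoundaryLimit, hglue.apply_eq_apply_inverted, J, hglue, fun J' => hglue.unique, B, hB,
    fun f => ?_⟩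
  rw [hJ]
  linear_combination B (pullback f) * Complex.I_sq
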